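/- Let $\mathcal S=\mathbb R/2\mathbb Z$ with the metric $d([x],[y])=\min\{|a-b| : a\in[x],\,b\in[y]\}$, and let $\mu\in(0,\tfrac12]$. The uniform compass model on $\mathbb Z$ with parameter $\mu$ is the process $(\eta_t(v))_{t\ge 0,\,v\in\mathbb Z}$ of $\mathcal S$-valued opinions defined as follows. The initial opinions $\eta_0(v)$, $v\in\mathbb Z$, are i.i.d. uniformly distributed on $\mathcal S$. Each edge $\langle v,v+1\rangle$ carries a Poisson clock of rate $1$; the clocks are independent of each other and of the initial opinions. When the clock on $\langle u,v\rangle$, $v=u+1$, rings at time $t$, let $\Delta\in(-1,1]$ be the number with $\eta_{t-}(u)+\Delta=\eta_{t-}(v)$ in $\mathcal S$. If $|\Delta|<1$, then the opinions at $u$ and $v$ are replaced by $$\eta_t(u)=\eta_{t-}(u)+\mu\Delta,\qquad \eta_t(v)=\eta_{t-}(v)-\mu\Delta ,$$ that is, both move a fraction $\mu$ towards each other along the geodesic between them. If $\Delta=1$ (diametrically opposed opinions), one of the two geodesics is selected by an independent fair coin, i.e. $(\eta_t(u),\eta_t(v))$ equals $(\eta_{t-}(u)+\mu,\ \eta_{t-}(v)-\mu)$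 or $(\eta_{t-}(u)-\mu,\ \eta_{t-}(v)+\mu)$, each with probability $\tfrac12$. All other opinions stay unchanged. (Almost surely, for every $t$ there are edges arbitrarily far to the left and to the right whose clocks have not rung by time $t$, so that these rules determine $\eta_t(v)$ for all $t\ge 0$ and $v\in\mathbb Z$.) Then for every fixed vertex $v\in\mathbb Z$, $$\mathbb P\Big(\lim_{t\to\infty}\eta_t(v)\text{ exists in }(\mathcal S,d)\Big)=0 .$$ -/

import Mathlib

open MeasureTheory ProbabilityTheory Filter Topology

namespace Compass

instance fact_two_pos : Fact ((0 : ℝ) < 2) := ⟨two_pos⟩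

/-- The opinion space `ℝ / 2ℤ`. Its metric is `d([x],[y]) = min {|a - b| : a ∈ [x], b ∈ [y]}`. -/
abbrev Opinion : Type := AddCircle (2 : ℝ)

/-- The edge difference: the unique `Δ ∈ (-1, 1]` with `x + Δ = y` in `ℝ / 2ℤ`.
The shortest arc from `x` to `y` has length `|Δ|`; it is unique unless `Δ = 1`. -/
noncomputable def edgeDiff (x y : Opinion) : ℝ :=
  (AddCircle.equivIoc (2 : ℝ) (-1) (y - x) : ℝ)

/-- The signed distance by which `x` moves towards `y` in an update with parameter `μ`: a fraction
`μ` of the geodesic from `x` to `y`. If `x` and `y` are diametrically opposed, the coin `c`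
selects one of the two geodesics. -/
noncomputable def displacement (μ : ℝ) (c : Bool) (x y : Opinion) : ℝ :=
  if edgeDiff x y = 1 then (if c then μ else -μ) else μ * edgeDiff x y

/-- The update of the configuration `η` on the edge `⟨e, e + 1⟩`: the two opinions move by the same
amount towards each other along a common geodesic, all other opinions are unchanged. -/
noncomputable def edgeUpdate (μ : ℝ) (e : ℤ) (c : Bool) (η : ℤ → Opinion) : ℤ → Opinion :=
  fun v =>
    if v = e then η e + (displacement μ c (η e) (η (e + 1)) : Opinion)
    else if v = e + 1 then η (e + 1) - (displacement μ c (η e) (η (e + 1)) : Opinion)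
    else η v

/-- The time of the `n`-th ring (`n = 0, 1, …`) of the clock on the edge `⟨e, e + 1⟩`,
when `gap e k` are the successive waiting times of that clock. -/
noncomputable def ringTime (gap : ℤ → ℕ → ℝ) (e : ℤ) (n : ℕ) : ℝ :=
  ∑ k ∈ Finset.range (n + 1), gap e k

/-- The rings up to time `t` in the finite box number `N` (the first `N` rings on each of the edges
`⟨e, e + 1⟩` with `-N ≤ e < N`), in chronological order. A pair `(e, n)` stands for
the `n`-th ring on `⟨e, e + 1⟩`. -/
noncomputable def boxRings (gap : ℤ → ℕ → ℝ) (N : ℕ) (t : ℝ) : List (ℤ × ℕ) :=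
  ((Finset.Ico (-(N : ℤ)) (N : ℤ) ×ˢ Finset.range N).filter
    (fun p => ringTime gap p.1 p.2 ≤ t)).toList.insertionSort
      (fun p q => ringTime gap p.1 p.2 ≤ ringTime gap q.1 q.2)

/-- The configuration at time `t` obtained from the initial configuration `x` by performing,
in chronological order, the updates belonging to the rings of the finite box number `N`. -/
noncomputable def boxState (μ : ℝ) (x : ℤ → Opinion) (gap : ℤ → ℕ → ℝ) (coin : ℤ → ℕ → Bool)
    (N : ℕ) (t : ℝ) : ℤ → Opinion :=
  (boxRings gap N t).foldl (fun η p => edgeUpdate μ p.1 (coin p.1 p.2) η) x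

/-- The opinion `η_t(v)` in the compass model on `ℤ`, as a function of the initial configuration,
of the waiting times of the clocks and of the coins (graphical construction). Almost surely, for
every `t` there are edges arbitrarily far to the left and to the right whose clocks have not rung
by time `t`; so the sequence of finite box values is eventually constant, and `η_t(v)` is
that constant. -/
noncomputable def opinion (μ : ℝ) (x : ℤ → Opinion) (gap : ℤ → ℕ → ℝ) (coin : ℤ → ℕ → Bool)
    (t : ℝ) (v : ℤ) : Opinion :=
  limUnder atTop (fun N : ℕ => boxState μ x gap coin N t v)

/-- The randomness of the uniform compass model on `ℤ`: i.i.d. uniform initial opinions `init v`,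
independent unit rate Poisson clocks on the edges (given by i.i.d. waiting times `gap e k`
that are exponential with parameter `1`) and independent fair coins `coin e n`, one for each ring,
the three families being independent of each other. -/
structure IsUniformCompassNoise {Ω : Type*} [MeasurableSpace Ω] (P : Measure Ω)
    (init : ℤ → Ω → Opinion) (gap : ℤ → ℕ → Ω → ℝ) (coin : ℤ → ℕ → Ω → Bool) : Prop where
  init_law : ∀ v, HasLaw (init v) AddCircle.haarAddCircle P
  gap_law : ∀ e k, HasLaw (gap e k) (expMeasure 1) P
  coin_law : ∀ e n, HasLaw (coin e n) (PMF.uniformOfFintype Bool).toMeasure P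
  init_indep : iIndepFun init P
  gap_indep : iIndepFun (fun p : ℤ × ℕ => gap p.1 p.2) P
  coin_indep : iIndepFun (fun p : ℤ × ℕ => coin p.1 p.2) P
  gap_coin_indep : IndepFun (fun ω (p : ℤ × ℕ) => gap p.1 p.2 ω)
    (fun ω (p : ℤ × ℕ) => coin p.1 p.2 ω) P
  init_gap_coin_indep : IndepFun (fun ω v => init v ω)
    (fun ω => ((fun p : ℤ × ℕ => gap p.1 p.2 ω), (fun p : ℤ × ℕ => coin p.1 p.2 ω))) P

end Compass

/-! It is enough to follow integer times. Suppose that the opinion at `v` converges to `L` along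
integers. During `(k, k + 1]`, with conditional probability `e⁻³` given the past, the edge `v` rings
exactly once while its two neighbouring edges stay silent. The opinion at `v` then moves by exactly
`μ` times its distance to the opinion at `v + 1`. If that distance exceeded some `ε` infinitely
often, Lévy's Borel-Cantelli lemma would produce infinitely many moves larger than `μ ε`, against
convergence. So the distance tends to `0`, and the opinion at `v + 1` converges to the same `L`
(`ae_tendsto_succ`).

Hence the event that the opinion at `v` converges to a point of `S` is almost surely contained in
its translates by `n ≥ 0`, and the zero-one law `measureReal_eq_sq_of_shift` gives `q = q²` for its
probability `q`. Take for `S` a half circle. Rotation by `1` exchanges `S` and its complement and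
preserves the law of the noise, so the complement has probability `q` as well. The two events are
disjoint, so `2q ≤ 1`, which forces `q = 0`; convergence to any limit at all has probability `2q =
0` (`noiseLaw_convergesIn_univ`).

The remaining work makes this rigorous for the graphical construction: for regular clocks the box
limit is a finite computation between two silent edges (`Regular.opinion_eq`), the state at time `k`
depends only on rings up to `k` (`eta_eq_opinionOfTimes`), and the clocks forget their past
(`clockLaw_clockPast_inter`). All of it takes place on the canonical product space `ℤ → Site`. -/

namespace Compass

/-! ### The dynamics driven by a list of rings -/

/-- The configuration obtained from `x` by performing the updates of a list of rings. -/
noncomputable def applyRings (μ : ℝ) (coin : ℤ → ℕ → Bool) (l : List (ℤ × ℕ))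
    (x : ℤ → Opinion) : ℤ → Opinion :=
  l.foldl (fun η p => edgeUpdate μ p.1 (coin p.1 p.2) η) x

@[simp] lemma applyRings_nil (μ : ℝ) (coin : ℤ → ℕ → Bool) (x : ℤ → Opinion) :
    applyRings μ coin [] x = x := rfl

@[simp] lemma applyRings_cons (μ : ℝ) (coin : ℤ → ℕ → Bool) (p : ℤ × ℕ) (l : List (ℤ × ℕ))
    (x : ℤ → Opinion) :
    applyRings μ coin (p :: l) x =
      applyRings μ coin l (edgeUpdate μ p.1 (coin p.1 p.2) x) := rfl

lemma applyRings_append (μ : ℝ) (coin : ℤ → ℕ → Bool) (l l' : List (ℤ × ℕ)) (x : ℤ → Opinion) :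
    applyRings μ coin (l ++ l') x = applyRings μ coin l' (applyRings μ coin l x) := by
  simp [applyRings, List.foldl_append]

lemma edgeUpdate_of_ne (μ : ℝ) {e v : ℤ} (c : Bool) (η : ℤ → Opinion) (h : v ≠ e)
    (h' : v ≠ e + 1) : edgeUpdate μ e c η v = η v := by
  simp [edgeUpdate, h, h']

lemma edgeUpdate_self (μ : ℝ) (e : ℤ) (c : Bool) (η : ℤ → Opinion) :
    edgeUpdate μ e c η e = η e + (displacement μ c (η e) (η (e + 1)) : Opinion) := by
  simp [edgeUpdate]

/-- The opinion at `v` does not change as long as its two edges are silent. -/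
lemma applyRings_of_silent (μ : ℝ) (coin : ℤ → ℕ → Bool) {v : ℤ} (l : List (ℤ × ℕ))
    (h : ∀ p ∈ l, p.1 ≠ v ∧ p.1 ≠ v - 1) (x : ℤ → Opinion) :
    applyRings μ coin l x v = x v := by
  induction l generalizing x with
  | nil => rfl
  | cons p l ih =>
    rw [applyRings_cons, ih (fun q hq => h q (List.mem_cons_of_mem _ hq))]
    have := h p List.mem_cons_self
    exact edgeUpdate_of_ne _ _ _ (by lia) (by lia)

/-- Between two silent edges `a < b`, only the rings of the edges in between matter. -/
lemma applyRings_eq_filter (μ : ℝ) (coin : ℤ → ℕ → Bool) {a b : ℤ} (l : List (ℤ × ℕ))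
    (h : ∀ p ∈ l, p.1 ≠ a ∧ p.1 ≠ b) (x y : ℤ → Opinion)
    (hxy : ∀ v, a < v → v ≤ b → x v = y v) (v : ℤ) (hav : a < v) (hvb : v ≤ b) :
    applyRings μ coin l x v =
      applyRings μ coin (l.filter (fun p => a < p.1 ∧ p.1 < b)) y v := by
  induction l generalizing x y with
  | nil => exact hxy v hav hvb
  | cons p l ih =>
    have hp := h p List.mem_cons_self
    have hl := fun q hq => h q (List.mem_cons_of_mem p hq)
    by_cases hpab : a < p.1 ∧ p.1 < b
    · rw [List.filter_cons_of_pos (by simpa using hpab), applyRings_cons, applyRings_cons]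
      refine ih hl _ _ fun w haw hwb => ?_
      unfold edgeUpdate
      rw [hxy p.1 (by lia) (by lia), hxy (p.1 + 1) (by lia) (by lia), hxy w haw hwb]
    · rw [List.filter_cons_of_neg (by simpa using hpab), applyRings_cons]
      refine ih hl _ _ fun w haw hwb => ?_
      rw [edgeUpdate_of_ne _ _ _ (by lia) (by lia), hxy w haw hwb]

/-- If, among the rings of `l`, exactly one concerns the edge `v` and none its neighbours, then the
effect of `l` on the opinion at `v` is that of a single update. -/
lemma applyRings_of_single (μ : ℝ) (coin : ℤ → ℕ → Bool) {v : ℤ} {n : ℕ} (l : List (ℤ × ℕ))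
    (hl : l.Nodup) (hn : (v, n) ∈ l)
    (h : ∀ p ∈ l, p ≠ (v, n) → p.1 ≠ v ∧ p.1 ≠ v - 1 ∧ p.1 ≠ v + 1) (x : ℤ → Opinion) :
    applyRings μ coin l x v =
      x v + (displacement μ (coin v n) (x v) (x (v + 1)) : Opinion) := by
  obtain ⟨l₁, l₂, rfl⟩ := List.append_of_mem hn
  have hne : ∀ p ∈ l₁ ++ l₂, p.1 ≠ v ∧ p.1 ≠ v - 1 ∧ p.1 ≠ v + 1 := by
    intro p hp
    refine h p (by simp only [List.mem_append, List.mem_cons] at hp ⊢; tauto) ?_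
    rintro rfl
    rw [List.nodup_middle] at hl
    exact (List.nodup_cons.1 hl).1 hp
  have h₁ : ∀ p ∈ l₁, p.1 ≠ v ∧ p.1 ≠ v - 1 ∧ p.1 ≠ v + 1 := fun p hp =>
    hne p (List.mem_append_left _ hp)
  have h₂ : ∀ p ∈ l₂, p.1 ≠ v ∧ p.1 ≠ v - 1 ∧ p.1 ≠ v + 1 := fun p hp =>
    hne p (List.mem_append_right _ hp)
  -- The opinion at `u` is touched only by the edges `u - 1` and `u`. So `l₁` and `l₂` fix the
  -- opinion at `v`, and `l₁` fixes the one at `v + 1` because the edge `v + 1` is silent.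
  rw [applyRings_append, applyRings_cons,
    applyRings_of_silent _ _ _ (fun p hp => ⟨(h₂ p hp).1, (h₂ p hp).2.1⟩), edgeUpdate_self,
    applyRings_of_silent _ _ _ (fun p hp => ⟨(h₁ p hp).1, (h₁ p hp).2.1⟩),
    applyRings_of_silent _ _ _ (fun p hp => ⟨(h₁ p hp).2.2, by have := h₁ p hp; lia⟩)]

/-! ### Equivariance of the updates -/

lemma edgeUpdate_shift (μ : ℝ) (e m : ℤ) (c : Bool) (η : ℤ → Opinion) :
    edgeUpdate μ e c (fun u => η (u + m)) = fun u => edgeUpdate μ (e + m) c η (u + m) := by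
  funext u
  simp only [edgeUpdate, add_left_inj, show e + 1 + m = e + m + 1 by ring,
    show (u + m = e + m + 1) = (u = e + 1) by apply propext; constructor <;> intro h <;> lia]

lemma applyRings_shift (μ : ℝ) (coin : ℤ → ℕ → Bool) (m : ℤ) (l : List (ℤ × ℕ))
    (x : ℤ → Opinion) :
    applyRings μ (fun e => coin (e + m)) l (fun u => x (u + m)) =
      fun u => applyRings μ coin (l.map fun p => (p.1 + m, p.2)) x (u + m) := by
  induction l generalizing x with
  | nil => rfl
  | cons p l ih =>
    rw [applyRings_cons, edgeUpdate_shift, ih (edgeUpdate μ (p.1 + m) (coin (p.1 + m) p.2) x)]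
    rfl

/-- An update sees the two opinions only through their difference. -/
lemma edgeUpdate_add (μ : ℝ) (e : ℤ) (c : Bool) (η : ℤ → Opinion) (r : Opinion) :
    edgeUpdate μ e c (fun u => η u + r) = fun u => edgeUpdate μ e c η u + r := by
  have hd : displacement μ c (η e + r) (η (e + 1) + r) = displacement μ c (η e) (η (e + 1)) := by
    have he : edgeDiff (η e + r) (η (e + 1) + r) = edgeDiff (η e) (η (e + 1)) := by
      rw [edgeDiff, edgeDiff, add_sub_add_right_eq_sub]
    rw [displacement, displacement, he]
  funext u
  simp only [edgeUpdate, hd]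
  split_ifs
  · rw [add_right_comm]
  · rw [add_sub_right_comm]
  · rfl

lemma applyRings_add (μ : ℝ) (coin : ℤ → ℕ → Bool) (l : List (ℤ × ℕ)) (x : ℤ → Opinion)
    (r : Opinion) :
    applyRings μ coin l (fun u => x u + r) = fun u => applyRings μ coin l x u + r := by
  induction l generalizing x with
  | nil => rfl
  | cons p l ih => rw [applyRings_cons, edgeUpdate_add, ih, applyRings_cons]

/-! ### The size of an update -/

lemma edgeDiff_mem (x y : Opinion) : edgeDiff x y ∈ Set.Ioc (-1 : ℝ) 1 := by
  have h : edgeDiff x y ∈ Set.Ioc (-1 : ℝ) (-1 + 2) :=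
    (AddCircle.equivIoc (2 : ℝ) (-1) (y - x)).2
  rwa [show (-1 : ℝ) + 2 = 1 by norm_num] at h

/-- Half the period is `1`; up to there the quotient norm is the absolute value. -/
lemma norm_coe_opinion {r : ℝ} (h : |r| ≤ 1) : ‖(r : Opinion)‖ = |r| := by
  rw [AddCircle.norm_coe_eq_abs_iff _ two_ne_zero]
  simpa using h

lemma abs_edgeDiff (x y : Opinion) : |edgeDiff x y| = dist x y := by
  have h := edgeDiff_mem x y
  rw [← norm_coe_opinion (abs_le.2 ⟨h.1.le, h.2⟩), edgeDiff, AddCircle.coe_equivIoc, dist_comm,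
    dist_eq_norm]

lemma norm_displacement {μ : ℝ} (hμ : 0 < μ) (hμ' : μ ≤ 1 / 2) (c : Bool) (x y : Opinion) :
    ‖(displacement μ c x y : Opinion)‖ = μ * dist x y := by
  -- The coin affects only the sign, and in the diametrical case the distance is `1`.
  have h : |displacement μ c x y| = μ * dist x y := by
    rw [← abs_edgeDiff, displacement]
    split_ifs with h1 h2
    · rw [h1, abs_of_pos hμ, abs_one, mul_one]
    · rw [h1, abs_neg, abs_of_pos hμ, abs_one, mul_one]
    · rw [abs_mul, abs_of_pos hμ]
  have hd := edgeDiff_mem x y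
  have hd' : dist x y ≤ 1 := by rw [← abs_edgeDiff]; exact abs_le.2 ⟨hd.1.le, hd.2⟩
  rw [norm_coe_opinion (by rw [h]; nlinarith [dist_nonneg (x := x) (y := y)]), h]

/-! ### The graphical construction for regular waiting times -/

/-- The properties of the clocks that hold almost surely and make the graphical construction
well defined at integer times. -/
structure Regular (gap : ℤ → ℕ → ℝ) : Prop where
  pos : ∀ e n, 0 < gap e n
  inj : Function.Injective (fun p : ℤ × ℕ => ringTime gap p.1 p.2)
  unbounded : ∀ (e : ℤ) (k : ℕ), ∃ n, (k : ℝ) < ringTime gap e n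
  silent_right : ∀ (k : ℕ) (v : ℤ), ∃ b, v ≤ b ∧ (k : ℝ) < gap b 0
  silent_left : ∀ (k : ℕ) (v : ℤ), ∃ a, a < v ∧ (k : ℝ) < gap a 0

/-- `l` lists in chronological order the rings up to time `t` on the edges strictly between
`a` and `b`. -/
structure IsHistory (gap : ℤ → ℕ → ℝ) (t : ℝ) (a b : ℤ) (l : List (ℤ × ℕ)) : Prop where
  sorted : l.Pairwise (fun p q => ringTime gap p.1 p.2 < ringTime gap q.1 q.2)
  mem_iff : ∀ p, p ∈ l ↔ (a < p.1 ∧ p.1 < b) ∧ ringTime gap p.1 p.2 ≤ t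

lemma IsHistory.nodup {gap : ℤ → ℕ → ℝ} {t : ℝ} {a b : ℤ} {l : List (ℤ × ℕ)}
    (h : IsHistory gap t a b l) : l.Nodup :=
  h.sorted.imp fun hpq hne => by subst hne; exact lt_irrefl _ hpq

/-- Strict sorting excludes ties, so the members determine the list. Lists obtained by different
sorts and filters can then be identified by comparing members. -/
lemma IsHistory.unique {gap : ℤ → ℕ → ℝ} {t : ℝ} {a b : ℤ} {l l' : List (ℤ × ℕ)}
    (h : IsHistory gap t a b l) (h' : IsHistory gap t a b l') : l = l' :=
  ((List.perm_ext_iff_of_nodup h.nodup h'.nodup).2 fun p => by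
    rw [h.mem_iff, h'.mem_iff]).eq_of_pairwise
    (fun _ _ _ _ hpq hqp => absurd (hpq.trans hqp) (lt_irrefl _)) h.sorted h'.sorted

lemma IsHistory.succ {gap : ℤ → ℕ → ℝ} {k : ℕ} {a b : ℤ} {l : List (ℤ × ℕ)}
    (hl : IsHistory gap (k + 1 : ℕ) a b l) :
    IsHistory gap k a b (l.filter fun p => ringTime gap p.1 p.2 ≤ k) ∧
      l = (l.filter fun p => ringTime gap p.1 p.2 ≤ k) ++
        l.filter fun p => (k : ℝ) < ringTime gap p.1 p.2 := by
  have hk : (k : ℝ) ≤ (k + 1 : ℕ) := by push_cast; linarith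
  refine ⟨⟨hl.sorted.filter _, fun p => ?_⟩, IsHistory.unique hl ⟨?_, fun p => ?_⟩⟩
  · rw [List.mem_filter, hl.mem_iff, decide_eq_true_eq]
    exact ⟨fun h => ⟨h.1.1, h.2⟩, fun h => ⟨⟨h.1, h.2.trans hk⟩, h.2⟩⟩
  · refine List.pairwise_append.2 ⟨hl.sorted.filter _, hl.sorted.filter _, fun p hp q hq => ?_⟩
    have h1 := of_decide_eq_true (List.mem_filter.1 hp).2
    have h2 := of_decide_eq_true (List.mem_filter.1 hq).2
    exact lt_of_le_of_lt h1 h2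
  · rw [List.mem_append, List.mem_filter, List.mem_filter, decide_eq_true_eq, decide_eq_true_eq,
      ← hl.mem_iff]
    rcases le_or_gt (ringTime gap p.1 p.2) k with h | h
    · simp [h]
    · simp [h]

lemma ringTime_zero (gap : ℤ → ℕ → ℝ) (e : ℤ) : ringTime gap e 0 = gap e 0 := by
  simp [ringTime]

lemma strictMono_ringTime {gap : ℤ → ℕ → ℝ} {e : ℤ} (h : ∀ n, 0 < gap e n) :
    StrictMono (ringTime gap e) :=
  strictMono_nat_of_lt_succ fun n => by
    rw [ringTime, ringTime, Finset.sum_range_succ _ (n + 1)]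
    linarith [h (n + 1)]

namespace Regular

variable {gap : ℤ → ℕ → ℝ} (hg : Regular gap)
include hg

lemma strictMono (e : ℤ) : StrictMono (ringTime gap e) :=
  strictMono_ringTime (hg.pos e)

lemma lt_ringTime_of_silent {a : ℤ} {t : ℝ} (ha : t < gap a 0) (n : ℕ) :
    t < ringTime gap a n := by
  rw [← ringTime_zero gap] at ha
  exact ha.trans_le ((hg.strictMono a).monotone (Nat.zero_le n))

lemma finite_rings (k : ℕ) (a b : ℤ) :
    {p : ℤ × ℕ | (a < p.1 ∧ p.1 < b) ∧ ringTime gap p.1 p.2 ≤ k}.Finite := by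
  choose n hn using fun e => hg.unbounded e k
  refine ((Set.finite_Ioo a b).biUnion fun e _ =>
    ((Set.finite_lt_nat (n e)).image (Prod.mk e))).subset ?_
  rintro ⟨e, m⟩ ⟨he, hm⟩
  refine Set.mem_biUnion (x := e) he ⟨m, ?_, rfl⟩
  exact (hg.strictMono e).lt_iff_lt.1 (lt_of_le_of_lt hm (hn e))

/-- Insertion sort only gives weak order; injectivity of the ring times makes it strict. -/
lemma sorted_insertionSort (s : Finset (ℤ × ℕ)) :
    (s.toList.insertionSort (fun p q => ringTime gap p.1 p.2 ≤ ringTime gap q.1 q.2)).Pairwise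
      (fun p q => ringTime gap p.1 p.2 < ringTime gap q.1 q.2) := by
  let r : ℤ × ℕ → ℤ × ℕ → Prop := fun p q => ringTime gap p.1 p.2 ≤ ringTime gap q.1 q.2
  have : Std.Total r := ⟨fun p q => le_total _ _⟩
  have : IsTrans _ r := ⟨fun _ _ _ => le_trans⟩
  have h1 := List.pairwise_insertionSort r s.toList
  have h2 : (s.toList.insertionSort r).Nodup :=
    (List.perm_insertionSort r s.toList).nodup_iff.2 s.nodup_toList
  exact (h1.and h2).imp fun hpq => lt_of_le_of_ne hpq.1 fun heq => hpq.2 (hg.inj heq)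

lemma exists_isHistory (k : ℕ) (a b : ℤ) : ∃ l, IsHistory gap k a b l :=
  ⟨(hg.finite_rings k a b).toFinset.toList.insertionSort
    (fun p q => ringTime gap p.1 p.2 ≤ ringTime gap q.1 q.2),
    hg.sorted_insertionSort _, fun p => by simp⟩

/-- The box values are eventually equal to the value computed from the rings between two
silent edges. -/
lemma eventually_boxState {μ : ℝ} {x : ℤ → Opinion} {coin : ℤ → ℕ → Bool} {k : ℕ} {a b v : ℤ}
    {l : List (ℤ × ℕ)} (ha : (k : ℝ) < gap a 0) (hb : (k : ℝ) < gap b 0) (hav : a < v)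
    (hvb : v ≤ b) (hl : IsHistory gap k a b l) :
    ∀ᶠ N in atTop, boxState μ x gap coin N k v = applyRings μ coin l x v := by
  -- From box `M` on, every ring of the finite history lies in the box.
  obtain ⟨M, hM⟩ : ∃ M : ℕ, ∀ p ∈ l, p.1.natAbs < M ∧ p.2 < M := by
    obtain ⟨M, hM⟩ := (l.toFinset.image fun p => p.1.natAbs + p.2).exists_nat_subset_range
    refine ⟨M, fun p hp => ?_⟩
    have := hM (Finset.mem_image_of_mem (fun p : ℤ × ℕ => p.1.natAbs + p.2)
      (List.mem_toFinset.2 hp))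
    rw [Finset.mem_range] at this
    lia
  filter_upwards [eventually_ge_atTop M] with N hN
  have hmem : ∀ p, p ∈ boxRings gap N k ↔
      ((-(N : ℤ) ≤ p.1 ∧ p.1 < N) ∧ p.2 < N) ∧ ringTime gap p.1 p.2 ≤ k := by
    intro p; simp [boxRings]
  have hne : ∀ p ∈ boxRings gap N k, p.1 ≠ a ∧ p.1 ≠ b := by
    intro p hp
    have h := ((hmem p).1 hp).2
    constructor
    · rintro rfl; exact absurd h (not_le.2 (hg.lt_ringTime_of_silent ha _))
    · rintro rfl; exact absurd h (not_le.2 (hg.lt_ringTime_of_silent hb _))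
  have hfil : IsHistory gap k a b
      ((boxRings gap N k).filter (fun p => a < p.1 ∧ p.1 < b)) := by
    refine ⟨(hg.sorted_insertionSort _).filter _, fun p => ?_⟩
    rw [List.mem_filter, hmem, decide_eq_true_eq]
    refine ⟨fun h => ⟨h.2, h.1.2⟩, fun h => ⟨⟨?_, h.2⟩, h.1⟩⟩
    have := hM p ((hl.mem_iff p).2 h)
    lia
  change applyRings μ coin (boxRings gap N k) x v = _
  rw [applyRings_eq_filter μ coin _ hne x x (fun _ _ _ => rfl) v hav hvb, hfil.unique hl]

lemma opinion_eq {μ : ℝ} {x : ℤ → Opinion} {coin : ℤ → ℕ → Bool} {k : ℕ} {a b v : ℤ}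
    {l : List (ℤ × ℕ)} (ha : (k : ℝ) < gap a 0) (hb : (k : ℝ) < gap b 0) (hav : a < v)
    (hvb : v ≤ b) (hl : IsHistory gap k a b l) :
    opinion μ x gap coin k v = applyRings μ coin l x v :=
  (tendsto_const_nhds.congr'
    ((hg.eventually_boxState ha hb hav hvb hl).mono fun _ h => h.symm)).limUnder_eq

/-- Translation equivariance of the graphical construction. -/
lemma opinion_shift (m : ℤ) (hg' : Regular fun e => gap (e + m)) (μ : ℝ) (x : ℤ → Opinion)
    (coin : ℤ → ℕ → Bool) (k : ℕ) (v : ℤ) :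
    opinion μ (fun u => x (u + m)) (fun e => gap (e + m)) (fun e => coin (e + m)) k v =
      opinion μ x gap coin k (v + m) := by
  obtain ⟨b, hvb, hb⟩ := hg'.silent_right k v
  obtain ⟨a, hav, ha⟩ := hg'.silent_left k v
  obtain ⟨l, hl⟩ := hg'.exists_isHistory k a b
  have hl' : IsHistory gap k (a + m) (b + m) (l.map fun p => (p.1 + m, p.2)) := by
    refine ⟨List.pairwise_map.2 hl.sorted, fun p => ?_⟩
    rw [List.mem_map]
    constructor
    · rintro ⟨q, hq, rfl⟩
      have := (hl.mem_iff q).1 hq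
      exact ⟨by simpa using this.1, this.2⟩
    · intro hp
      refine ⟨(p.1 - m, p.2), (hl.mem_iff _).2 ⟨by dsimp only; lia, ?_⟩, by simp⟩
      have := hp.2
      simpa [ringTime] using this
  rw [hg'.opinion_eq ha hb hav hvb hl, applyRings_shift,
    hg.opinion_eq (a := a + m) (b := b + m) ha hb (by lia) (by lia) hl']

/-- Rotation equivariance of the graphical construction. -/
lemma opinion_add (μ : ℝ) (x : ℤ → Opinion) (coin : ℤ → ℕ → Bool) (k : ℕ) (v : ℤ)
    (r : Opinion) :
    opinion μ (fun u => x u + r) gap coin k v = opinion μ x gap coin k v + r := by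
  obtain ⟨b, hvb, hb⟩ := hg.silent_right k v
  obtain ⟨a, hav, ha⟩ := hg.silent_left k v
  obtain ⟨l, hl⟩ := hg.exists_isHistory k a b
  rw [hg.opinion_eq ha hb hav hvb hl, hg.opinion_eq ha hb hav hvb hl, applyRings_add]

/-- If in the time interval `(k, k + 1]` the edge `v` rings exactly once and its two neighbours
are silent, then the opinion at `v` moves by `μ` times the distance to the opinion at `v + 1`. -/
lemma dist_opinion_succ {μ : ℝ} (hμ : 0 < μ) (hμ' : μ ≤ 1 / 2) (x : ℤ → Opinion)
    (coin : ℤ → ℕ → Bool) {k : ℕ} {v : ℤ}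
    (hleft : ∀ n, ringTime gap (v - 1) n ∉ Set.Ioc (k : ℝ) (k + 1))
    (hright : ∀ n, ringTime gap (v + 1) n ∉ Set.Ioc (k : ℝ) (k + 1))
    (hv : ∃! n, ringTime gap v n ∈ Set.Ioc (k : ℝ) (k + 1)) :
    dist (opinion μ x gap coin (k + 1 : ℕ) v) (opinion μ x gap coin k v) =
      μ * dist (opinion μ x gap coin k v) (opinion μ x gap coin k (v + 1)) := by
  obtain ⟨n, hn, hn'⟩ := hv
  -- One pair of silent edges must enclose both `v` and `v + 1`, up to the later time.
  obtain ⟨b, hvb, hb⟩ := hg.silent_right (k + 1) (v + 1)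
  obtain ⟨a, hav, ha⟩ := hg.silent_left (k + 1) v
  have hk : (k : ℝ) ≤ (k + 1 : ℕ) := by push_cast; linarith
  obtain ⟨l, hl⟩ := hg.exists_isHistory (k + 1) a b
  obtain ⟨hl₁, hl₂⟩ := hl.succ
  set l₁ := l.filter fun p => ringTime gap p.1 p.2 ≤ k with hl₁_def
  set l₂ := l.filter fun p => (k : ℝ) < ringTime gap p.1 p.2 with hl₂_def
  have hmem : ∀ p, p ∈ l₂ ↔ (a < p.1 ∧ p.1 < b) ∧
      ringTime gap p.1 p.2 ∈ Set.Ioc (k : ℝ) (k + 1) := by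
    intro p
    rw [hl₂_def, List.mem_filter, hl.mem_iff, decide_eq_true_eq, Set.mem_Ioc]
    push_cast
    tauto
  rw [hg.opinion_eq ha hb hav (by lia) hl, hl₂, applyRings_append,
    hg.opinion_eq (hk.trans_lt ha) (hk.trans_lt hb) hav (by lia) hl₁,
    hg.opinion_eq (hk.trans_lt ha) (hk.trans_lt hb) (by lia) hvb hl₁,
    applyRings_of_single (n := n) μ coin l₂ (hl.nodup.filter _) ((hmem _).2 ⟨by lia, hn⟩),
    dist_eq_norm, add_sub_cancel_left, norm_displacement hμ hμ']
  intro p hp hpn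
  have h := ((hmem p).1 hp).2
  refine ⟨fun h1 => hpn ?_, fun h1 => hleft p.2 (h1 ▸ h), fun h1 => hright p.2 (h1 ▸ h)⟩
  exact Prod.ext h1 (hn' p.2 (by rw [← h1]; exact h))

end Regular

/-! ### Measurability of the graphical construction -/

lemma measurable_edgeDiff {α : Type*} [MeasurableSpace α] {f g : α → Opinion}
    (hf : Measurable f) (hg : Measurable g) : Measurable fun a => edgeDiff (f a) (g a) :=
  measurable_subtype_coe.comp
    ((AddCircle.measurableEquivIoc (2 : ℝ) (-1)).measurable.comp (hg.sub hf))

lemma measurable_displacement {α : Type*} [MeasurableSpace α] (μ : ℝ) {c : α → Bool}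
    {f g : α → Opinion} (hc : Measurable c) (hf : Measurable f) (hg : Measurable g) :
    Measurable fun a => displacement μ (c a) (f a) (g a) :=
  Measurable.ite (measurable_edgeDiff hf hg (measurableSet_singleton 1))
    (Measurable.ite (hc (measurableSet_singleton true)) measurable_const measurable_const)
    ((measurable_edgeDiff hf hg).const_mul μ)

lemma measurable_edgeUpdate {α : Type*} [MeasurableSpace α] (μ : ℝ) (e : ℤ) {c : α → Bool}
    {η : α → ℤ → Opinion} (hc : Measurable c) (hη : ∀ v, Measurable fun a => η a v) (v : ℤ) :
    Measurable fun a => edgeUpdate μ e (c a) (η a) v := by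
  have hd : Measurable fun a => (displacement μ (c a) (η a e) (η a (e + 1)) : Opinion) :=
    AddCircle.measurable_mk'.comp (measurable_displacement μ hc (hη e) (hη (e + 1)))
  unfold edgeUpdate
  split_ifs
  · exact (hη e).add hd
  · exact (hη (e + 1)).sub hd
  · exact hη v

lemma measurable_applyRings {α : Type*} [MeasurableSpace α] (μ : ℝ) {coin : α → ℤ → ℕ → Bool}
    (hc : ∀ e n, Measurable fun a => coin a e n) (l : List (ℤ × ℕ)) {x : α → ℤ → Opinion}
    (hx : ∀ v, Measurable fun a => x a v) (v : ℤ) :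
    Measurable fun a => applyRings μ (coin a) l (x a) v := by
  induction l generalizing x with
  | nil => exact hx v
  | cons p l ih =>
    exact ih (x := fun a => edgeUpdate μ p.1 (coin a p.1 p.2) (x a))
      fun w => measurable_edgeUpdate μ p.1 (hc p.1 p.2) hx w

/-! ### Measurable dependence on the ring times -/

/-- The rings up to time `t` in the box number `N`, in chronological order, as a function of the
array of ring times. -/
noncomputable def sortedRings (τ : ℤ → ℕ → ℝ) (N : ℕ) (t : ℝ) : List (ℤ × ℕ) :=
  ((Finset.Ico (-(N : ℤ)) (N : ℤ) ×ˢ Finset.range N).filter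
    (fun p => τ p.1 p.2 ≤ t)).toList.insertionSort (fun p q => τ p.1 p.2 ≤ τ q.1 q.2)

/-- Only finitely many comparisons enter the list, and the order matters only among rings up to `t`.
The first fact yields measurability, the second invariance under censoring. -/
lemma sortedRings_congr {τ τ' : ℤ → ℕ → ℝ} {N : ℕ} {t : ℝ}
    (h₁ : ∀ p ∈ Finset.Ico (-(N : ℤ)) (N : ℤ) ×ˢ Finset.range N,
      τ p.1 p.2 ≤ t ↔ τ' p.1 p.2 ≤ t)
    (h₂ : ∀ p ∈ Finset.Ico (-(N : ℤ)) (N : ℤ) ×ˢ Finset.range N,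
      ∀ q ∈ Finset.Ico (-(N : ℤ)) (N : ℤ) ×ˢ Finset.range N, τ p.1 p.2 ≤ t → τ q.1 q.2 ≤ t →
      (τ p.1 p.2 ≤ τ q.1 q.2 ↔ τ' p.1 p.2 ≤ τ' q.1 q.2)) :
    sortedRings τ N t = sortedRings τ' N t := by
  rw [sortedRings, sortedRings, ← Finset.filter_congr h₁]
  -- Mapping by `id` compares insertion sort for two relations that agree on the list.
  have := List.map_insertionSort (fun p q : ℤ × ℕ => τ p.1 p.2 ≤ τ q.1 q.2)
    (fun p q : ℤ × ℕ => τ' p.1 p.2 ≤ τ' q.1 q.2) id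
    ((Finset.Ico (-(N : ℤ)) (N : ℤ) ×ˢ Finset.range N).filter (fun p => τ p.1 p.2 ≤ t)).toList
    (fun p hp q hq => by
      rw [Finset.mem_toList, Finset.mem_filter] at hp hq
      exact h₂ p hp.1 q hq.1 hp.2 hq.2)
  simpa using this

/-- A function that depends only on the truth values of finitely many measurable conditions is
measurable. -/
lemma measurable_of_forall_iff {α β ι : Type*} [MeasurableSpace α] [MeasurableSpace β] [Finite ι]
    {f : α → β} (g : ι → α → Prop) (hg : ∀ i, MeasurableSet {a | g i a})
    (h : ∀ a b, (∀ i, g i a ↔ g i b) → f a = f b) : Measurable f := by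
  have hG : Measurable fun a i => g i a := 
    measurable_pi_lambda _ fun i => measurableSet_setOfPred.1 (hg i)
  rcases isEmpty_or_nonempty β with hβ | hβ
  · have : IsEmpty α := ⟨fun a => hβ.false (f a)⟩
    exact measurable_of_empty f
  have hf : Function.FactorsThrough f (fun a i => g i a) := fun a b hab =>
    h a b fun i => iff_of_eq (congrFun hab i)
  have : f = Function.extend (fun a i => g i a) f (fun _ => Classical.choice hβ) ∘
      fun a i => g i a := funext fun a => (hf.extend_apply _ a).symm
  rw [this]
  exact (measurable_of_finite _).comp hG

lemma measurable_sortedRings {α : Type*} [MeasurableSpace α] [MeasurableSpace (List (ℤ × ℕ))]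
    {τ : α → ℤ → ℕ → ℝ} (hτ : ∀ e n, Measurable fun a => τ a e n) (N : ℕ) (t : ℝ) :
    Measurable fun a => sortedRings (τ a) N t := by
  let I := ↥(Finset.Ico (-(N : ℤ)) (N : ℤ) ×ˢ Finset.range N)
  refine measurable_of_forall_iff (ι := I ⊕ I × I)
    (fun i a => i.elim (fun p => τ a p.1.1 p.1.2 ≤ t)
      (fun p => τ a p.1.1.1 p.1.1.2 ≤ τ a p.2.1.1 p.2.1.2)) ?_ ?_
  · rintro (p | p)
    · exact measurableSet_le (hτ _ _) measurable_const
    · exact measurableSet_le (hτ _ _) (hτ _ _)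
  · intro a b h
    exact sortedRings_congr (fun p hp => h (Sum.inl ⟨p, hp⟩))
      fun p hp q hq _ _ => h (Sum.inr (⟨p, hp⟩, ⟨q, hq⟩))

/-- The noise attached to a vertex: its initial opinion and the waiting times and coins of the
edge to its right. -/
abbrev Site : Type := Opinion × (ℕ → ℝ) × (ℕ → Bool)

/-- The opinion at `v` at time `k` as a function of the initial opinions, of the ring times and of
the coins. -/
noncomputable def opinionOfTimes (μ : ℝ) (k : ℕ) (v : ℤ) (y : ℤ → Site) : Opinion :=
  limUnder atTop fun N : ℕ =>
    applyRings μ (fun e => (y e).2.2) (sortedRings (fun e => (y e).2.1) N k) (fun u => (y u).1) v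

lemma measurable_opinionOfTimes (μ : ℝ) (k : ℕ) (v : ℤ) : Measurable (opinionOfTimes μ k v) := by
  refine (StronglyMeasurable.limUnder fun N => Measurable.stronglyMeasurable ?_).measurable
  -- There are countably many lists, so with the discrete σ-algebra it suffices to treat each fixed
  -- list.
  let _ : MeasurableSpace (List (ℤ × ℕ)) := ⊤
  have h1 : Measurable fun q : List (ℤ × ℕ) × (ℤ → Site) =>
      applyRings μ (fun e => (q.2 e).2.2) q.1 (fun u => (q.2 u).1) v :=
    measurable_from_prod_countable_right fun l =>
      measurable_applyRings μ (fun e n => by fun_prop) l (fun u => by fun_prop) v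
  have h2 : Measurable fun y : ℤ → Site => sortedRings (fun e => (y e).2.1) N k :=
    measurable_sortedRings (fun e n => by fun_prop) N k
  exact h1.comp (h2.prodMk measurable_id)

/-- The opinion at `v` at the integer time `k`. -/
noncomputable def eta (μ : ℝ) (x : ℤ → Site) (k : ℕ) (v : ℤ) : Opinion :=
  opinion μ (fun u => (x u).1) (fun e => (x e).2.1) (fun e => (x e).2.2) k v

/-! ### The filtration of the past -/

/-- The `n`-th ring time of a single clock. -/
noncomputable def clockTime (g : ℕ → ℝ) (n : ℕ) : ℝ := ∑ i ∈ Finset.range (n + 1), g i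

@[fun_prop]
lemma measurable_clockTime (n : ℕ) : Measurable fun g => clockTime g n := by
  unfold clockTime; fun_prop

/-- The ring time `s` as seen by an observer at time `t`. -/
noncomputable def censor (t s : ℝ) : ℝ := if s ≤ t then s else t + 1

@[fun_prop]
lemma measurable_censor (t : ℝ) : Measurable (censor t) :=
  Measurable.ite measurableSet_Iic measurable_id measurable_const

/-- The replacement value `t + 1` matters only in that it exceeds `t`: hidden rings stay hidden. -/
lemma censor_le_iff {t s : ℝ} : censor t s ≤ t ↔ s ≤ t := by
  unfold censor; split_ifs with h
  · simp [h]
  · simp [h]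

lemma censor_of_le {t s : ℝ} (h : s ≤ t) : censor t s = s := if_pos h

/-- The earlier observation is a function of the later one; this makes `past` increasing. -/
lemma censor_censor {t t' s : ℝ} (h : t ≤ t') : censor t (censor t' s) = censor t s := by
  unfold censor
  split_ifs <;> first | rfl | (exfalso; linarith)

/-- What an observer at time `k` knows about a clock. -/
noncomputable def clockPast (k : ℕ) (g : ℕ → ℝ) : ℕ → ℝ := fun n => censor k (clockTime g n)

@[fun_prop]
lemma measurable_clockPast (k : ℕ) : Measurable (clockPast k) :=
  measurable_pi_lambda _ fun n => (measurable_censor _).comp (measurable_clockTime n)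

/-- What an observer at time `k` knows about the noise at a vertex; the coins are all visible. -/
noncomputable def sitePast (k : ℕ) (s : Site) : Site := (s.1, clockPast k s.2.1, s.2.2)

@[fun_prop]
lemma measurable_sitePast (k : ℕ) : Measurable (sitePast k) := by
  unfold sitePast; fun_prop

/-- Rings after time `k` are never performed, and censoring leaves the others unchanged. This is
what makes `eta` adapted to `past`. -/
lemma eta_eq_opinionOfTimes (μ : ℝ) (x : ℤ → Site) (k : ℕ) (v : ℤ) :
    eta μ x k v = opinionOfTimes μ k v fun u => sitePast k (x u) := by
  unfold eta opinion opinionOfTimes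
  congr 1
  funext N
  change applyRings μ (fun e => (x e).2.2) (sortedRings (fun e n => clockTime (x e).2.1 n) N k)
    (fun u => (x u).1) v = _
  rw [sortedRings_congr (τ' := fun e => (sitePast k (x e)).2.1)]
  · rfl
  · exact fun p _ => censor_le_iff.symm
  · intro p _ q _ hp hq
    change _ ↔ censor k _ ≤ censor k _
    rw [censor_of_le hp, censor_of_le hq]

lemma measurable_eta (μ : ℝ) (k : ℕ) (v : ℤ) : Measurable fun x => eta μ x k v := by
  simp_rw [eta_eq_opinionOfTimes]
  exact (measurable_opinionOfTimes μ k v).comp (by fun_prop)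

/-- The information available at time `k`. -/
noncomputable def past : Filtration ℕ (inferInstance : MeasurableSpace (ℤ → Site)) where
  seq k := MeasurableSpace.comap (fun x u => sitePast k (x u)) inferInstance
  mono' := by
    intro k k' hk
    have h : (fun (x : ℤ → Site) u => sitePast k (x u)) =
        (fun (y : ℤ → Site) u => ((y u).1, (fun n => censor k ((y u).2.1 n)), (y u).2.2)) ∘
          fun x u => sitePast k' (x u) := by
      funext x u
      simp only [sitePast, Function.comp, clockPast]
      congr 2
      funext n
      exact (censor_censor (by exact_mod_cast hk)).symm
    dsimp only
    rw [h, ← MeasurableSpace.comap_comp]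
    refine MeasurableSpace.comap_mono (Measurable.comap_le ?_)
    fun_prop
  le' k := Measurable.comap_le (by fun_prop)

lemma measurable_past_eta (μ : ℝ) (k : ℕ) (v : ℤ) :
    Measurable[past k] fun x => eta μ x k v := by
  simp_rw [eta_eq_opinionOfTimes]
  exact (measurable_opinionOfTimes μ k v).comp (comap_measurable _)

/-- The edge `v` is silent during `(k, k + 1]`. -/
def silentSet (k : ℕ) : Set (ℕ → ℝ) := {g | ∀ n, clockTime g n ∉ Set.Ioc (k : ℝ) (k + 1)}

/-- The edge `v` rings exactly once during `(k, k + 1]`. -/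
def singleSet (k : ℕ) : Set (ℕ → ℝ) := {g | ∃! n, clockTime g n ∈ Set.Ioc (k : ℝ) (k + 1)}

lemma measurableSet_forall_notMem_Ioc (k : ℕ) :
    MeasurableSet {t : ℕ → ℝ | ∀ n, t n ∉ Set.Ioc (k : ℝ) (k + 1)} := by
  have : {t : ℕ → ℝ | ∀ n, t n ∉ Set.Ioc (k : ℝ) (k + 1)} =
      ⋂ n, {t : ℕ → ℝ | t n ∈ Set.Ioc (k : ℝ) (k + 1)}ᶜ := by ext; simp
  rw [this]
  exact MeasurableSet.iInter fun n => (measurable_pi_apply n measurableSet_Ioc).compl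

lemma measurableSet_existsUnique_mem_Ioc (k : ℕ) :
    MeasurableSet {t : ℕ → ℝ | ∃! n, t n ∈ Set.Ioc (k : ℝ) (k + 1)} := by
  have : {t : ℕ → ℝ | ∃! n, t n ∈ Set.Ioc (k : ℝ) (k + 1)} =
      ⋃ n, {t : ℕ → ℝ | t n ∈ Set.Ioc (k : ℝ) (k + 1)} ∩
      ⋂ m, {t : ℕ → ℝ | t m ∈ Set.Ioc (k : ℝ) (k + 1) → m = n} := by
    ext; simp [ExistsUnique]
  rw [this]
  refine MeasurableSet.iUnion fun n => (measurable_pi_apply n measurableSet_Ioc).inter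
    (MeasurableSet.iInter fun m => ?_)
  by_cases h : m = n
  · simp [h]
  · simp only [h, imp_false]
    exact (measurable_pi_apply m measurableSet_Ioc).compl

lemma measurableSet_silentSet (k : ℕ) : MeasurableSet (silentSet k) :=
  (measurable_pi_lambda _ measurable_clockTime) (measurableSet_forall_notMem_Ioc k)

lemma measurableSet_singleSet (k : ℕ) : MeasurableSet (singleSet k) :=
  (measurable_pi_lambda _ measurable_clockTime) (measurableSet_existsUnique_mem_Ioc k)

/-- A ring hidden at time `k + 1` is recorded as `k + 2`, outside the interval; so isolated rings in
`(k, k + 1]` are visible at time `k + 1`. -/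
lemma censor_mem_Ioc_iff {k : ℕ} {s : ℝ} :
    censor (k + 1 : ℕ) s ∈ Set.Ioc (k : ℝ) (k + 1) ↔ s ∈ Set.Ioc (k : ℝ) (k + 1) := by
  unfold censor
  push_cast
  split_ifs with h
  · rfl
  · simp only [Set.mem_Ioc]
    constructor <;> intro h' <;> exfalso <;> linarith [h'.2]

/-- The edge `v` rings exactly once during `(k, k + 1]` and its neighbours are silent. -/
def isolatedRing (k : ℕ) (v : ℤ) : Set (ℤ → Site) :=
  {x | (x (v - 1)).2.1 ∈ silentSet k ∧ (x v).2.1 ∈ singleSet k ∧ (x (v + 1)).2.1 ∈ silentSet k}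

lemma measurableSet_past_isolatedRing (k : ℕ) (v : ℤ) :
    MeasurableSet[past (k + 1)] (isolatedRing k v) := by
  refine ⟨{y | (y (v - 1)).2.1 ∈ {t : ℕ → ℝ | ∀ n, t n ∉ Set.Ioc (k : ℝ) (k + 1)} ∧
    (y v).2.1 ∈ {t : ℕ → ℝ | ∃! n, t n ∈ Set.Ioc (k : ℝ) (k + 1)} ∧
    (y (v + 1)).2.1 ∈ {t : ℕ → ℝ | ∀ n, t n ∉ Set.Ioc (k : ℝ) (k + 1)}}, ?_, ?_⟩
  · have hc : ∀ u, Measurable fun y : ℤ → Site => (y u).2.1 := fun u => by fun_prop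
    exact (hc _ (measurableSet_forall_notMem_Ioc k)).inter
      ((hc _ (measurableSet_existsUnique_mem_Ioc k)).inter
        (hc _ (measurableSet_forall_notMem_Ioc k)))
  · ext x
    simp only [Set.preimage_ofPred_eq, isolatedRing, silentSet, singleSet, sitePast, clockPast,
      Set.mem_ofPred_eq, censor_mem_Ioc_iff]

/-! ### Infinite products of probability measures -/

section InfinitePi

variable {ι : Type*} {X A B : Type*} [MeasurableSpace X] [MeasurableSpace A] [MeasurableSpace B]

lemma comap_pi_eq_generateFrom_squareCylinders {Ω : Type*} (F : Ω → ι → X) :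
    MeasurableSpace.pi.comap F = MeasurableSpace.generateFrom
      {s | ∃ t ∈ squareCylinders (fun _ : ι => {s : Set X | MeasurableSet s}), F ⁻¹' t = s} := by
  rw [generateFrom_squareCylinders.symm, MeasurableSpace.comap_generateFrom]
  rfl

/-- Coordinatewise applied functions that are independent for each factor are independent under
the product measure. -/
lemma indepFun_infinitePi_map {ν : Measure X} [IsProbabilityMeasure ν] {f : X → A} {g : ι → X → B}
    (hf : Measurable f) (hg : ∀ i, Measurable (g i)) (h : ∀ i, IndepFun f (g i) ν) :
    IndepFun (fun (x : ι → X) i => f (x i)) (fun x i => g i (x i))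
      (Measure.infinitePi fun _ : ι => ν) := by
  classical
  refine IndepSets.indep (Measurable.comap_le (by fun_prop)) (Measurable.comap_le (by fun_prop))
    (IsPiSystem.comap (isPiSystem_squareCylinders
      (fun _ => MeasurableSpace.isPiSystem_measurableSet) (by simp)) _)
    (IsPiSystem.comap (isPiSystem_squareCylinders
      (fun _ => MeasurableSpace.isPiSystem_measurableSet) (by simp)) _)
    (comap_pi_eq_generateFrom_squareCylinders _)
    (comap_pi_eq_generateFrom_squareCylinders _) ?_
  rw [IndepSets_iff]
  rintro - - ⟨-, ⟨I, s, hs, rfl⟩, rfl⟩ ⟨-, ⟨J, t, ht, rfl⟩, rfl⟩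
  simp only [Set.mem_pi, Set.mem_univ, Set.mem_ofPred_eq, forall_const] at hs ht
  -- Padding with `univ` puts both cylinders over the common base `I ∪ J`, where the product formula
  -- factorizes coordinate by coordinate.
  set S : ι → Set A := fun i => if i ∈ I then s i else Set.univ with hS_def
  set T : ι → Set B := fun i => if i ∈ J then t i else Set.univ with hT_def
  have hS : ∀ i, MeasurableSet (S i) := fun i => by
    simp only [hS_def]; split_ifs; exacts [hs i, MeasurableSet.univ]
  have hT : ∀ i, MeasurableSet (T i) := fun i => by
    simp only [hT_def]; split_ifs; exacts [ht i, MeasurableSet.univ]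
  have h1 : (fun (x : ι → X) i => f (x i)) ⁻¹' (I : Set ι).pi s =
      ((I ∪ J : Finset ι) : Set ι).pi fun i => f ⁻¹' S i := by
    ext x
    simp only [Set.mem_preimage, Set.mem_pi, Finset.mem_coe, Finset.mem_union, hS_def]
    refine ⟨fun h i _ => ?_, fun h i hi => by simpa [hi] using h i (Or.inl hi)⟩
    split_ifs with hi
    exacts [h i hi, Set.mem_univ _]
  have h2 : (fun (x : ι → X) i => g i (x i)) ⁻¹' (J : Set ι).pi t =
      ((I ∪ J : Finset ι) : Set ι).pi fun i => g i ⁻¹' T i := by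
    ext x
    simp only [Set.mem_preimage, Set.mem_pi, Finset.mem_coe, Finset.mem_union, hT_def]
    refine ⟨fun h i _ => ?_, fun h i hi => by simpa [hi] using h i (Or.inr hi)⟩
    split_ifs with hi
    exacts [h i hi, Set.mem_univ _]
  rw [h1, h2, ← Set.pi_inter_distrib,
    Measure.infinitePi_pi _ fun i _ => (hf (hS i)).inter (hg i (hT i)),
    Measure.infinitePi_pi _ fun i _ => hf (hS i), Measure.infinitePi_pi _ fun i _ => hg i (hT i),
    ← Finset.prod_mul_distrib]
  exact Finset.prod_congr rfl fun i _ => (h i).measure_inter_preimage_eq_mul _ _ (hS i) (hT i)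

/-- A product of two infinite product measures is an infinite product of product measures. -/
lemma map_zip_infinitePi_prod (κ : Measure A) (δ : Measure B) [IsProbabilityMeasure κ]
    [IsProbabilityMeasure δ] :
    ((Measure.infinitePi fun _ : ι => κ).prod (Measure.infinitePi fun _ : ι => δ)).map
      (fun p i => (p.1 i, p.2 i)) = Measure.infinitePi fun _ : ι => κ.prod δ := by
  -- Under the product of pair laws the two coordinate sequences are independent, so splitting has
  -- the product law; zipping undoes the splitting.
  have h := indepFun_infinitePi_map (ι := ι) (ν := κ.prod δ) measurable_fst
    (fun _ => measurable_snd)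
    fun _ => (indepFun_prod (X := id) (Y := id) measurable_id measurable_id)
  have hm1 : Measurable fun (x : ι → A × B) i => (x i).1 := by fun_prop
  have hm2 : Measurable fun (x : ι → A × B) i => (x i).2 := by fun_prop
  rw [indepFun_iff_map_prod_eq_prod_map_map hm1.aemeasurable hm2.aemeasurable,
    Measure.infinitePi_map_pi (μ := fun _ : ι => κ.prod δ) (f := fun _ => Prod.fst)
      (fun _ => measurable_fst),
    Measure.infinitePi_map_pi (μ := fun _ : ι => κ.prod δ) (f := fun _ => Prod.snd)
      (fun _ => measurable_snd)] at h
  have h1 : (κ.prod δ).map Prod.fst = κ := by simp [Measure.map_fst_prod]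
  have h2 : (κ.prod δ).map Prod.snd = δ := by simp [Measure.map_snd_prod]
  simp only [h1, h2] at h
  rw [← h, Measure.map_map (by fun_prop) (by fun_prop)]
  exact Measure.map_id

lemma hasLaw_zip {Ω : Type*} [MeasurableSpace Ω] {P : Measure Ω} [IsProbabilityMeasure P]
    {κ : Measure A} {δ : Measure B} [IsProbabilityMeasure κ] [IsProbabilityMeasure δ]
    {f : Ω → ι → A} {g : Ω → ι → B} (hf : HasLaw f (Measure.infinitePi fun _ : ι => κ) P)
    (hg : HasLaw g (Measure.infinitePi fun _ : ι => δ) P) (h : IndepFun f g P) :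
    HasLaw (fun ω i => (f ω i, g ω i)) (Measure.infinitePi fun _ : ι => κ.prod δ) P := by
  have hz : Measurable fun (p : (ι → A) × (ι → B)) i => (p.1 i, p.2 i) := by fun_prop
  have hfg := hf.aemeasurable.prodMk hg.aemeasurable
  refine ⟨hz.comp_aemeasurable hfg, ?_⟩
  rw [indepFun_iff_map_prod_eq_prod_map_map hf.aemeasurable hg.aemeasurable, hf.map_eq,
    hg.map_eq] at h
  rw [← map_zip_infinitePi_prod, ← h, AEMeasurable.map_map_of_aemeasurable hz.aemeasurable hfg]
  rfl

/-! ### Shifts and the zero-one law -/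

/-- The shift on bi-infinite sequences. -/
def shift (m : ℤ) (x : ℤ → X) : ℤ → X := fun v => x (v + m)

@[fun_prop]
lemma measurable_shift (m : ℤ) : Measurable (shift m : (ℤ → X) → ℤ → X) := by
  unfold shift; fun_prop

lemma measurePreserving_shift (ν : Measure X) [IsProbabilityMeasure ν] (m : ℤ) :
    MeasurePreserving (shift m) (Measure.infinitePi fun _ : ℤ => ν)
      (Measure.infinitePi fun _ : ℤ => ν) :=
  ⟨measurable_shift m, Measure.map_infinitePi_infinitePi_of_inj (P := fun _ : ℤ => ν)
    (f := fun v : ℤ => v + m) (add_left_injective m)⟩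

/-- Cylinder events are independent of their far away translates. -/
lemma exists_shift_cylinder_inter (ν : Measure X) [IsProbabilityMeasure ν] (I : Finset ℤ)
    {S : Set (I → X)} (hS : MeasurableSet S) :
    ∃ n : ℕ, (Measure.infinitePi fun _ : ℤ => ν).real
        (cylinder (α := fun _ : ℤ => X) I S ∩ shift n ⁻¹' cylinder (α := fun _ : ℤ => X) I S) =
      (Measure.infinitePi fun _ : ℤ => ν).real (cylinder (α := fun _ : ℤ => X) I S) ^ 2 := by
  obtain ⟨M, hM⟩ : ∃ M : ℕ, ∀ i ∈ I, i.natAbs < M := by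
    obtain ⟨M, hM⟩ := (I.image Int.natAbs).exists_nat_subset_range
    exact ⟨M, fun i hi => Finset.mem_range.1 (hM (Finset.mem_image_of_mem _ hi))⟩
  -- The base lies in `(-M, M)`, so a shift by `2 * M` makes it disjoint from itself.
  refine ⟨2 * M, ?_⟩
  set n : ℤ := ((2 * M : ℕ) : ℤ) with hn
  have hdisj : Disjoint I (I.image (· + n)) := by
    rw [Finset.disjoint_left]
    intro i hi hi'
    obtain ⟨j, hj, rfl⟩ := Finset.mem_image.1 hi'
    have h1 := hM j hj
    have h2 := hM _ hi
    lia
  have hind := (iIndepFun_infinitePi (P := fun _ : ℤ => ν) (X := fun _ => id)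
    (fun _ => measurable_id)).indepFun_finset I (I.image (· + n)) hdisj (fun i => by fun_prop)
  have hφ : Measurable fun (y : ↥(I.image (· + n)) → X) (i : I) =>
      y ⟨i.1 + n, Finset.mem_image_of_mem _ i.2⟩ := by fun_prop
  have := (hind.comp measurable_id hφ).measure_inter_preimage_eq_mul _ _ hS hS
  have hpre : (Measure.infinitePi fun _ : ℤ => ν)
      (shift n ⁻¹' cylinder (α := fun _ : ℤ => X) I S) =
      (Measure.infinitePi fun _ : ℤ => ν) (cylinder (α := fun _ : ℤ => X) I S) :=
    (measurePreserving_shift ν n).measure_preimage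
      (MeasurableSet.cylinder I hS).nullMeasurableSet
  have hkey : (Measure.infinitePi fun _ : ℤ => ν)
        (cylinder (α := fun _ : ℤ => X) I S ∩ shift n ⁻¹' cylinder (α := fun _ : ℤ => X) I S) =
      (Measure.infinitePi fun _ : ℤ => ν) (cylinder (α := fun _ : ℤ => X) I S) *
      (Measure.infinitePi fun _ : ℤ => ν)
        (shift n ⁻¹' cylinder (α := fun _ : ℤ => X) I S) := this
  rw [measureReal_def, measureReal_def, hkey, hpre, ENNReal.toReal_mul, sq]

/-- **Zero-one law**: an event that is almost surely contained in all its translates has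
probability `0` or `1`. -/
lemma measureReal_eq_sq_of_shift (ν : Measure X) [IsProbabilityMeasure ν] {E : Set (ℤ → X)}
    (hE : MeasurableSet E)
    (h : ∀ n : ℕ, ∀ᵐ x ∂(Measure.infinitePi fun _ : ℤ => ν), x ∈ E → shift n x ∈ E) :
    (Measure.infinitePi fun _ : ℤ => ν).real E =
      (Measure.infinitePi fun _ : ℤ => ν).real E ^ 2 := by
  set Q := Measure.infinitePi fun _ : ℤ => ν with hQ
  refine eq_of_abs_sub_le_all fun ε hε => ?_
  -- The tolerance `ε / 4` is spent four times: on `E` and its translate in `h2`, and twice in `h4`,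
  -- since `|c² - q²| ≤ 2 |c - q|` on `[0, 1]`.
  obtain ⟨t, ht, hEt⟩ := (Measure.MeasureDense.of_generateFrom_isSetAlgebra_finite Q
    (isSetAlgebra_measurableCylinders (α := fun _ : ℤ => X))
    generateFrom_measurableCylinders.symm).approx E hE (measure_ne_top _ _) (ε / 4) (by positivity)
  obtain ⟨I, S, hS, rfl⟩ := (mem_measurableCylinders t).1 ht
  set C := cylinder (α := fun _ : ℤ => X) I S with hC_def
  have hC : MeasurableSet C := MeasurableSet.cylinder I hS
  obtain ⟨n, hn⟩ := exists_shift_cylinder_inter ν I hS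
  rw [← hQ, ← hC_def] at hn
  have hEC : Q.real (symmDiff E C) ≤ ε / 4 := by
    rw [measureReal_def]
    exact ENNReal.toReal_le_of_le_ofReal (by positivity) hEt.le
  have hEC' : Q.real (shift n ⁻¹' symmDiff E C) ≤ ε / 4 := by
    rw [(measurePreserving_shift ν (n : ℤ)).measureReal_preimage
      (hE.symmDiff hC).nullMeasurableSet]
    exact hEC
  -- The only use of the hypothesis on translates.
  have h1 : Q.real E = Q.real (E ∩ shift n ⁻¹' E) := by
    refine measureReal_congr ?_
    filter_upwards [h n] with x hx
    exact propext ⟨fun hxE => ⟨hxE, hx hxE⟩, fun hxE => hxE.1⟩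
  have h2 : |Q.real (E ∩ shift n ⁻¹' E) - Q.real (C ∩ shift n ⁻¹' C)| ≤ ε / 4 + ε / 4 := by
    refine (abs_measureReal_sub_le_measureReal_symmDiff
      (hE.inter (measurable_shift _ hE)).nullMeasurableSet
      (hC.inter (measurable_shift _ hC)).nullMeasurableSet).trans ?_
    refine (measureReal_mono ?_).trans ((measureReal_union_le _ _).trans (add_le_add hEC hEC'))
    intro x hx
    simp only [Set.mem_symmDiff, Set.mem_inter_iff, Set.mem_preimage, Set.mem_union] at hx ⊢
    tauto
  have h3 : |Q.real C - Q.real E| ≤ ε / 4 := by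
    rw [abs_sub_comm]
    exact (abs_measureReal_sub_le_measureReal_symmDiff hE.nullMeasurableSet
      hC.nullMeasurableSet).trans hEC
  have hC1 : Q.real C ≤ 1 := measureReal_le_one
  have hE1 : Q.real E ≤ 1 := measureReal_le_one
  have hC0 : 0 ≤ Q.real C := measureReal_nonneg
  have hE0 : 0 ≤ Q.real E := measureReal_nonneg
  rw [← h1, hn] at h2
  have h4 : |Q.real C ^ 2 - Q.real E ^ 2| ≤ ε / 4 + ε / 4 := by
    rw [sq_sub_sq, abs_mul, abs_of_nonneg (add_nonneg hC0 hE0)]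
    nlinarith [abs_nonneg (Q.real C - Q.real E)]
  calc |Q.real E - Q.real E ^ 2| ≤ |Q.real E - Q.real C ^ 2| + |Q.real C ^ 2 - Q.real E ^ 2| :=
        abs_sub_le _ _ _
    _ ≤ (ε / 4 + ε / 4) + (ε / 4 + ε / 4) := add_le_add h2 h4
    _ = ε := by ring

end InfinitePi

/-! ### The law of the noise -/

instance : IsProbabilityMeasure (expMeasure 1) := isProbabilityMeasure_expMeasure one_pos

/-- The law of the waiting times of one clock. -/
noncomputable def clockLaw : Measure (ℕ → ℝ) := Measure.infinitePi fun _ : ℕ => expMeasure 1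

instance : IsProbabilityMeasure clockLaw := by unfold clockLaw; infer_instance

/-- The law of the coins of one edge. -/
noncomputable def coinLaw : Measure (ℕ → Bool) :=
  Measure.infinitePi fun _ : ℕ => (PMF.uniformOfFintype Bool).toMeasure

instance : IsProbabilityMeasure coinLaw := by unfold coinLaw; infer_instance

/-- The law of the noise at one vertex. -/
noncomputable def siteLaw : Measure Site :=
  (AddCircle.haarAddCircle : Measure Opinion).prod (clockLaw.prod coinLaw)

instance : IsProbabilityMeasure siteLaw := by unfold siteLaw; infer_instance

/-- The law of the noise. -/
noncomputable def noiseLaw : Measure (ℤ → Site) := Measure.infinitePi fun _ : ℤ => siteLaw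

instance : IsProbabilityMeasure noiseLaw := by unfold noiseLaw; infer_instance

/-- A family of i.i.d. variables indexed by `ℤ × ℕ` is a family of i.i.d. sequences. -/
lemma hasLaw_curry {Ω A : Type*} [MeasurableSpace Ω] [MeasurableSpace A] {P : Measure Ω}
    [IsProbabilityMeasure P] {κ : Measure A} [IsProbabilityMeasure κ] {X : ℤ → ℕ → Ω → A}
    (hX : ∀ e n, HasLaw (X e n) κ P) (hi : iIndepFun (fun p : ℤ × ℕ => X p.1 p.2) P) :
    HasLaw (fun ω e n => X e n ω)
      (Measure.infinitePi fun _ : ℤ => Measure.infinitePi fun _ : ℕ => κ) P := by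
  have h1 : HasLaw (fun ω (p : ℤ × ℕ) => X p.1 p.2 ω) (Measure.infinitePi fun _ : ℤ × ℕ => κ) P :=
    hi.hasLaw_infinitePi (fun p => hX p.1 p.2)
      (aemeasurable_pi_iff.2 fun p => (hX p.1 p.2).aemeasurable)
  have hc : HasLaw (MeasurableEquiv.curry ℤ ℕ A)
      (Measure.infinitePi fun _ : ℤ => Measure.infinitePi fun _ : ℕ => κ)
      (Measure.infinitePi fun _ : ℤ × ℕ => κ) :=
    ⟨(MeasurableEquiv.curry ℤ ℕ A).measurable.aemeasurable,
      Measure.infinitePi_map_curry (fun _ _ => κ)⟩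
  exact hc.comp h1

lemma IsUniformCompassNoise.hasLaw {Ω : Type*} [MeasurableSpace Ω] {P : Measure Ω}
    [IsProbabilityMeasure P] {init : ℤ → Ω → Opinion} {gap : ℤ → ℕ → Ω → ℝ}
    {coin : ℤ → ℕ → Ω → Bool} (h : IsUniformCompassNoise P init gap coin) :
    HasLaw (fun ω v => ((init v ω, (fun n => gap v n ω), fun n => coin v n ω) : Site))
      noiseLaw P := by
  have hi : HasLaw (fun ω v => init v ω)
      (Measure.infinitePi fun _ : ℤ => AddCircle.haarAddCircle) P :=
    h.init_indep.hasLaw_infinitePi h.init_law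
      (aemeasurable_pi_iff.2 fun v => (h.init_law v).aemeasurable)
  have hgl : HasLaw (fun ω e n => gap e n ω) (Measure.infinitePi fun _ : ℤ => clockLaw) P :=
    hasLaw_curry h.gap_law h.gap_indep
  have hcl : HasLaw (fun ω e n => coin e n ω) (Measure.infinitePi fun _ : ℤ => coinLaw) P :=
    hasLaw_curry h.coin_law h.coin_indep
  have hgc : HasLaw (fun ω v => ((fun n => gap v n ω), fun n => coin v n ω))
      (Measure.infinitePi fun _ : ℤ => clockLaw.prod coinLaw) P := by
    have hind : IndepFun (fun ω e n => gap e n ω) (fun ω e n => coin e n ω) P :=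
      h.gap_coin_indep.comp (φ := fun (z : ℤ × ℕ → ℝ) e n => z (e, n))
        (ψ := fun (z : ℤ × ℕ → Bool) e n => z (e, n)) (by fun_prop) (by fun_prop)
    exact hasLaw_zip hgl hcl hind
  have hind : IndepFun (fun ω v => init v ω)
      (fun ω v => ((fun n => gap v n ω), fun n => coin v n ω)) P :=
    h.init_gap_coin_indep.comp (φ := id) measurable_id
      (ψ := fun (z : (ℤ × ℕ → ℝ) × (ℤ × ℕ → Bool)) v =>
        ((fun n => z.1 (v, n)), fun n => z.2 (v, n))) (by fun_prop)
  exact hasLaw_zip hi hgc hind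

/-- The rotation of all initial opinions by `r`. -/
noncomputable def rotate (r : Opinion) (x : ℤ → Site) : ℤ → Site := fun v => ((x v).1 + r, (x v).2)

/-- Haar measure is translation invariant, and the clocks and coins are untouched. -/
lemma measurePreserving_rotate (r : Opinion) :
    MeasurePreserving (rotate r) noiseLaw noiseLaw := by
  have h : MeasurePreserving (Prod.map (· + r) id : Site → Site) siteLaw siteLaw :=
    (measurePreserving_add_right _ r).prod (MeasurePreserving.id _)
  refine ⟨by unfold rotate; fun_prop, ?_⟩
  have := Measure.infinitePi_map_pi (μ := fun _ : ℤ => siteLaw)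
    (f := fun _ => (Prod.map (· + r) id : Site → Site)) fun _ => h.measurable
  rw [h.map_eq] at this
  exact this

/-! ### The clocks are almost surely regular -/

/-- Second Borel-Cantelli lemma for i.i.d. variables. -/
lemma ae_frequently_mem_of_iid {Ω A : Type*} [MeasurableSpace Ω] [MeasurableSpace A]
    {P : Measure Ω} [IsProbabilityMeasure P] {κ : Measure A} {X : ℕ → Ω → A}
    (hm : ∀ n, Measurable (X n)) (hκ : ∀ n, P.map (X n) = κ) (hX : iIndepFun X P) {S : Set A}
    (hS : MeasurableSet S) (h0 : κ S ≠ 0) : ∀ᵐ ω ∂P, ∃ᶠ n in atTop, X n ω ∈ S := by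
  have hms : ∀ n, MeasurableSet (X n ⁻¹' S) := fun n => hm n hS
  have hP : ∀ n, P (X n ⁻¹' S) = κ S := fun n => by rw [← hκ n, Measure.map_apply (hm n) hS]
  have hind : iIndepSet (fun n => X n ⁻¹' S) P := by
    rw [iIndepSet_iff_meas_biInter hms]
    exact fun s => hX.measure_inter_preimage_eq_mul s (fun i _ => hS)
  have h1 := measure_limsup_eq_one hms hind
    (by simp_rw [hP]; exact ENNReal.tsum_const_eq_top_of_ne_zero h0)
  have h2 : MeasurableSet (limsup (fun n => X n ⁻¹' S) atTop) :=
    MeasurableSet.measurableSet_limsup hms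
  rw [← prob_compl_eq_zero_iff h2] at h1
  filter_upwards [measure_eq_zero_iff_ae_notMem.1 h1] with ω hω
  rw [Set.notMem_compl_iff, mem_limsup_iff_frequently_mem] at hω
  exact hω

/-- Independent variables, one of which has no atoms, are almost surely different. -/
lemma measure_eq_eq_zero_of_indepFun {Ω : Type*} [MeasurableSpace Ω] {P : Measure Ω}
    [IsProbabilityMeasure P] {X Y : Ω → ℝ} (hX : Measurable X) (hY : Measurable Y)
    (h : IndepFun X Y P) (h0 : ∀ c, P.map X {c} = 0) : P {ω | X ω = Y ω} = 0 := by
  rw [indepFun_iff_map_prod_eq_prod_map_map hX.aemeasurable hY.aemeasurable] at h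
  have hd : MeasurableSet {p : ℝ × ℝ | p.1 = p.2} :=
    measurableSet_eq_fun measurable_fst measurable_snd
  have : {ω | X ω = Y ω} = (fun ω => (X ω, Y ω)) ⁻¹' {p : ℝ × ℝ | p.1 = p.2} := rfl
  rw [this, ← Measure.map_apply (hX.prodMk hY) hd, h, Measure.prod_apply_symm hd]
  simp [Set.preimage, h0]

instance : NullSingletonClass (expMeasure 1) := by
  unfold expMeasure gammaMeasure; infer_instance

lemma expMeasure_one_Ioi {t : ℝ} (ht : 0 ≤ t) :
    expMeasure 1 (Set.Ioi t) = ENNReal.ofReal (Real.exp (-t)) := by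
  have h1 := cdf_expMeasure_eq one_pos t
  rw [if_pos ht, one_mul] at h1
  have h2 := ofReal_cdf (expMeasure 1) t
  rw [← Set.compl_Iic, prob_compl_eq_one_sub measurableSet_Iic, ← h2, h1,
    ← ENNReal.ofReal_one, ← ENNReal.ofReal_sub _ (by simpa using ht)]
  ring_nf

lemma iIndepFun_clockLaw : iIndepFun (fun n (g : ℕ → ℝ) => g n) clockLaw :=
  iIndepFun_infinitePi (P := fun _ : ℕ => expMeasure 1) (X := fun _ => id) fun _ => measurable_id

lemma map_clockLaw (n : ℕ) : clockLaw.map (fun g => g n) = expMeasure 1 :=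
  Measure.infinitePi_map_eval _ n

lemma indepFun_clockLaw_sum (n : ℕ) :
    IndepFun (fun g : ℕ → ℝ => g n) (fun g => ∑ i ∈ Finset.range n, g i) clockLaw := by
  have := iIndepFun_clockLaw.indepFun_finsetSum_of_notMem (fun n => measurable_pi_apply n)
    (s := Finset.range n) (i := n) (by simp)
  refine this.symm.congr (ae_of_all _ fun g => rfl) (ae_of_all _ fun g => ?_)
  simp

/-- The last waiting time has no atoms and is independent of the sum of the earlier ones. -/
lemma map_clockTime_singleton (n : ℕ) (c : ℝ) :
    clockLaw.map (fun g => clockTime g n) {c} = 0 := by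
  rw [Measure.map_apply (measurable_clockTime n) (measurableSet_singleton c)]
  have := measure_eq_eq_zero_of_indepFun (P := clockLaw) (X := fun g => g n)
    (Y := fun g => c - ∑ i ∈ Finset.range n, g i) (by fun_prop) (by fun_prop)
    ((indepFun_clockLaw_sum n).comp measurable_id (measurable_const.sub measurable_id))
    (fun c => by rw [map_clockLaw]; exact measure_singleton c)
  refine measure_mono_null (fun g hg => ?_) this
  have : clockTime g n = c := hg
  rw [clockTime, Finset.sum_range_succ] at this
  change g n = _
  linarith

lemma ae_clockLaw_pos : ∀ᵐ g ∂clockLaw, ∀ n, 0 < g n := by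
  refine ae_all_iff.2 fun n => ?_
  have : ∀ᵐ t ∂(expMeasure 1), 0 < t := by
    have h0 := expMeasure_one_Ioi le_rfl
    rw [neg_zero, Real.exp_zero, ENNReal.ofReal_one,
      ← prob_compl_eq_zero_iff measurableSet_Ioi] at h0
    exact h0
  rw [← map_clockLaw n] at this
  exact ae_of_ae_map (measurable_pi_apply n).aemeasurable this

/-- Bounded ring times would make the waiting times summable, hence null; but infinitely many of
them exceed `1`. -/
lemma ae_clockLaw_unbounded : ∀ᵐ g ∂clockLaw, ∀ k : ℕ, ∃ n, (k : ℝ) < clockTime g n := by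
  have h := ae_frequently_mem_of_iid (P := clockLaw) (fun n => measurable_pi_apply n) map_clockLaw
    iIndepFun_clockLaw (measurableSet_Ioi (a := (1 : ℝ)))
    (by rw [expMeasure_one_Ioi zero_le_one]; simpa using Real.exp_pos _)
  filter_upwards [h, ae_clockLaw_pos] with g hg hpos k
  by_contra! hk
  have hs : Summable g := by
    refine summable_of_sum_range_le (c := k) (fun n => (hpos n).le) fun n => ?_
    refine le_trans ?_ (hk n)
    rw [clockTime, Finset.sum_range_succ]
    linarith [hpos n]
  refine hg ?_
  filter_upwards [hs.tendsto_atTop_zero.eventually_lt_const one_pos] with n hn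
  exact not_lt.2 hn.le

/-- The law of the waiting times of all clocks. -/
noncomputable def gapLaw : Measure (ℤ → ℕ → ℝ) := Measure.infinitePi fun _ : ℤ => clockLaw

instance : IsProbabilityMeasure gapLaw := by unfold gapLaw; infer_instance

lemma map_gapLaw (e : ℤ) : gapLaw.map (fun gap => gap e) = clockLaw :=
  Measure.infinitePi_map_eval _ e

lemma iIndepFun_gapLaw : iIndepFun (fun e (gap : ℤ → ℕ → ℝ) => gap e) gapLaw :=
  iIndepFun_infinitePi (P := fun _ : ℤ => clockLaw) (X := fun _ => id) fun _ => measurable_id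

/-- The edges `f n` are independent, and each is silent up to time `k` with the same probability
`e⁻ᵏ`. -/
lemma ae_exists_silent (f : ℕ → ℤ) (hf : Function.Injective f) (k : ℕ) :
    ∀ᵐ gap ∂gapLaw, ∃ n, (k : ℝ) < gap (f n) 0 := by
  have h := ae_frequently_mem_of_iid (P := gapLaw) (κ := clockLaw)
    (X := fun n gap => gap (f n)) (fun n => measurable_pi_apply _) (fun n => map_gapLaw _)
    (iIndepFun_gapLaw.precomp hf) (S := (fun g => g 0) ⁻¹' Set.Ioi (k : ℝ))
    (measurable_pi_apply 0 measurableSet_Ioi)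
    (by
      rw [← Measure.map_apply (by fun_prop) measurableSet_Ioi, map_clockLaw,
        expMeasure_one_Ioi (Nat.cast_nonneg k)]
      simpa using Real.exp_pos _)
  filter_upwards [h] with gap hgap
  exact hgap.exists

lemma ae_gapLaw_regular : ∀ᵐ gap ∂gapLaw, Regular gap := by
  have hpos : ∀ᵐ gap ∂gapLaw, ∀ e n, 0 < gap e n := ae_all_iff.2 fun e =>
    ae_of_ae_map (μ := gapLaw) (f := fun gap => gap e)
      (measurable_pi_apply e).aemeasurable
      (by rw [map_gapLaw]; exact ae_clockLaw_pos)
  have hunb : ∀ᵐ gap ∂gapLaw, ∀ e, ∀ k : ℕ, ∃ n, (k : ℝ) < clockTime (gap e) n :=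
    ae_all_iff.2 fun e => ae_of_ae_map (μ := gapLaw) (f := fun gap => gap e)
      (measurable_pi_apply e).aemeasurable
      (by rw [map_gapLaw]; exact ae_clockLaw_unbounded)
  -- Ties between different edges are excluded by independence; on a single edge the ring times
  -- increase strictly.
  have hne : ∀ᵐ gap ∂gapLaw, ∀ p q : ℤ × ℕ, p.1 ≠ q.1 →
      clockTime (gap p.1) p.2 ≠ clockTime (gap q.1) q.2 := by
    refine ae_all_iff.2 fun p => ae_all_iff.2 fun q => ?_
    by_cases hpq : p.1 = q.1
    · exact ae_of_all _ fun gap h => absurd hpq h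
    have := measure_eq_eq_zero_of_indepFun (P := gapLaw)
      (X := fun gap => clockTime (gap p.1) p.2) (Y := fun gap => clockTime (gap q.1) q.2)
      (by fun_prop) (by fun_prop)
      ((iIndepFun_gapLaw.indepFun hpq).comp (measurable_clockTime p.2) (measurable_clockTime q.2))
      (fun c => by
        have h := map_clockTime_singleton p.2 c
        rw [← map_gapLaw p.1, Measure.map_map (by fun_prop) (by fun_prop)] at h
        exact h)
    filter_upwards [measure_eq_zero_iff_ae_notMem.1 this] with gap h _ using h
  have hr : ∀ᵐ gap ∂gapLaw, ∀ (k : ℕ) (v : ℤ), ∃ n : ℕ, (k : ℝ) < gap (v + n) 0 :=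
    ae_all_iff.2 fun k => ae_all_iff.2 fun v =>
      ae_exists_silent (fun n => v + n) (fun a b h => by simpa using h) k
  have hl : ∀ᵐ gap ∂gapLaw, ∀ (k : ℕ) (v : ℤ), ∃ n : ℕ, (k : ℝ) < gap (v - 1 - n) 0 :=
    ae_all_iff.2 fun k => ae_all_iff.2 fun v =>
      ae_exists_silent (fun n => v - 1 - n) (fun a b h => by simpa using h) k
  filter_upwards [hpos, hunb, hne, hr, hl] with gap h1 h2 h3 h4 h5
  refine ⟨h1, ?_, h2, fun k v => ?_, fun k v => ?_⟩
  · rintro ⟨e, n⟩ ⟨f, m⟩ hpq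
    have hef : e = f := by
      by_contra hef
      exact h3 (e, n) (f, m) hef hpq
    subst hef
    exact Prod.ext rfl ((strictMono_ringTime (h1 e)).injective hpq)
  · obtain ⟨n, hn⟩ := h4 k v
    exact ⟨v + n, by lia, hn⟩
  · obtain ⟨n, hn⟩ := h5 k v
    exact ⟨v - 1 - n, by lia, hn⟩

lemma map_siteLaw : siteLaw.map (fun s => s.2.1) = clockLaw := by
  have h1 : siteLaw.map Prod.snd = clockLaw.prod coinLaw := by
    simp [siteLaw, Measure.map_snd_prod]
  have h2 : (clockLaw.prod coinLaw).map Prod.fst = clockLaw := by simp [Measure.map_fst_prod]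
  rw [← h2, ← h1, Measure.map_map measurable_fst measurable_snd]
  rfl

lemma map_noiseLaw : noiseLaw.map (fun x e => (x e).2.1) = gapLaw := by
  have := Measure.infinitePi_map_pi (μ := fun _ : ℤ => siteLaw)
    (f := fun _ => fun s : Site => s.2.1) fun _ => by fun_prop
  rw [map_siteLaw] at this
  exact this

/-- The clocks are almost surely regular. -/
lemma ae_regular : ∀ᵐ x ∂noiseLaw, Regular fun e => (x e).2.1 :=
  ae_of_ae_map (μ := noiseLaw) (f := fun x e => (x e).2.1)
    (Measurable.aemeasurable (by fun_prop))
    (by rw [map_noiseLaw]; exact ae_gapLaw_regular)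

/-! ### The loss of memory of the clocks -/

lemma expMeasure_one_eq :
    expMeasure 1 = volume.withDensity fun x : ℝ =>
      ENNReal.ofReal (if 0 ≤ x then Real.exp (-x) else 0) := by
  unfold expMeasure gammaMeasure
  congr 1
  funext x
  have h : gammaPDF 1 1 x = exponentialPDF 1 x := rfl
  rw [h]
  simpa using exponentialPDF_eq 1 x

lemma measurable_expDensity :
    Measurable fun x : ℝ => ENNReal.ofReal (if 0 ≤ x then Real.exp (-x) else 0) :=
  ENNReal.measurable_ofReal.comp
    (Measurable.ite measurableSet_Ici (by fun_prop) measurable_const)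

/-- The probability that exactly one ring occurs in the time interval `(s, s + 1]` and the first
ring is after time `s`. -/
lemma expMeasure_prod_single {s : ℝ} (hs : 0 ≤ s) :
    ((expMeasure 1).prod (expMeasure 1))
      {z : ℝ × ℝ | s < z.1 ∧ z.1 ≤ s + 1 ∧ s + 1 < z.1 + z.2} =
      ENNReal.ofReal (Real.exp (-(s + 1))) := by
  have hm : MeasurableSet {z : ℝ × ℝ | s < z.1 ∧ z.1 ≤ s + 1 ∧ s + 1 < z.1 + z.2} :=
    (measurableSet_lt measurable_const measurable_fst).inter
      ((measurableSet_le measurable_fst measurable_const).inter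
        (measurableSet_lt measurable_const (measurable_fst.add measurable_snd)))
  have hsec : ∀ x : ℝ, (expMeasure 1)
      (Prod.mk x ⁻¹' {z : ℝ × ℝ | s < z.1 ∧ z.1 ≤ s + 1 ∧ s + 1 < z.1 + z.2}) =
      (Set.Ioc s (s + 1)).indicator (fun x => ENNReal.ofReal (Real.exp (-(s + 1 - x)))) x := by
    intro x
    by_cases hx : x ∈ Set.Ioc s (s + 1)
    · rw [Set.indicator_of_mem hx, ← expMeasure_one_Ioi (by linarith [hx.2])]
      congr 1
      ext y
      simp only [Set.mem_preimage, Set.mem_ofPred_eq, Set.mem_Ioi]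
      exact ⟨fun h => by linarith [h.2.2], fun h => ⟨hx.1, hx.2, by linarith⟩⟩
    · rw [Set.indicator_of_notMem hx]
      convert measure_empty (μ := expMeasure 1)
      ext y
      simp only [Set.mem_preimage, Set.mem_ofPred_eq, Set.mem_empty_iff_false, iff_false]
      exact fun h => hx ⟨h.1, h.2.1⟩
  rw [Measure.prod_apply hm]
  simp_rw [hsec]
  rw [lintegral_indicator measurableSet_Ioc, expMeasure_one_eq,
    setLIntegral_withDensity_eq_setLIntegral_mul _ measurable_expDensity (by fun_prop)
      measurableSet_Ioc,
    setLIntegral_congr_fun (g := fun _ => ENNReal.ofReal (Real.exp (-(s + 1)))) measurableSet_Ioc]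
  · simp
  · intro x hx
    have hx0 : 0 ≤ x := hs.trans hx.1.le
    simp only [Pi.mul_apply, if_pos hx0]
    rw [← ENNReal.ofReal_mul (Real.exp_pos _).le, ← Real.exp_add]
    ring_nf

lemma expMeasure_prod_Ioi {s : ℝ} (hs : 0 ≤ s) :
    ((expMeasure 1).prod (expMeasure 1)) {z : ℝ × ℝ | s < z.1} =
      ENNReal.ofReal (Real.exp (-s)) := by
  have : {z : ℝ × ℝ | s < z.1} = Set.Ioi s ×ˢ Set.univ := by ext; simp
  rw [this, Measure.prod_prod, measure_univ, mul_one, expMeasure_one_Ioi hs]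

lemma measure_eq_tsum_of_ae {Ω : Type*} [MeasurableSpace Ω] {P : Measure Ω} {T : Set Ω}
    {U : ℕ → Set Ω} (hU : ∀ j, MeasurableSet (U j)) (hT : ∀ᵐ ω ∂P, ω ∈ T ↔ ∃ j, ω ∈ U j)
    (hd : ∀ᵐ ω ∂P, ∀ i j, ω ∈ U i → ω ∈ U j → i = j) : P T = ∑' j, P (U j) := by
  have h1 : P T = P (⋃ j, U j) := measure_congr (by
    filter_upwards [hT] with ω hω
    exact propext (hω.trans Set.mem_iUnion.symm))
  rw [h1, measure_iUnion₀ (fun i j hij => ?_) fun j => (hU j).nullMeasurableSet]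
  refine measure_mono_null (t := {ω | ¬ ∀ i j, ω ∈ U i → ω ∈ U j → i = j}) ?_ hd
  exact fun ω hω h => hij (h i j hω.1 hω.2)

/-- Waiting times with infinitely many rings but finitely many in every bounded interval. -/
structure RegularClock (g : ℕ → ℝ) : Prop where
  pos : ∀ n, 0 < g n
  unbounded : ∀ k : ℕ, ∃ n, (k : ℝ) < clockTime g n

lemma ae_regularClock : ∀ᵐ g ∂clockLaw, RegularClock g := by
  filter_upwards [ae_clockLaw_pos, ae_clockLaw_unbounded] with g h1 h2 using ⟨h1, h2⟩

/-- The sum of the first `j` waiting times. -/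
noncomputable def waitSum (j : ℕ) (g : ℕ → ℝ) : ℝ := ∑ i ∈ Finset.range j, g i

@[fun_prop]
lemma measurable_waitSum (j : ℕ) : Measurable (waitSum j) := by unfold waitSum; fun_prop

lemma clockTime_eq_waitSum (g : ℕ → ℝ) (n : ℕ) : clockTime g n = waitSum (n + 1) g := rfl

lemma waitSum_succ (j : ℕ) (g : ℕ → ℝ) : waitSum (j + 1) g = waitSum j g + g j :=
  Finset.sum_range_succ _ _

lemma RegularClock.monotone {g : ℕ → ℝ} (hg : RegularClock g) : Monotone fun j => waitSum j g :=
  monotone_nat_of_le_succ fun n => by rw [waitSum_succ]; linarith [hg.pos n]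

/-- Such a `j` is the number of rings up to time `k`. With `unique_waitSum`, the events for
different `j` partition the regular clocks. -/
lemma RegularClock.exists_waitSum {g : ℕ → ℝ} (hg : RegularClock g) (k : ℕ) :
    ∃ j, waitSum j g ≤ k ∧ k < waitSum (j + 1) g := by
  classical
  refine ⟨Nat.find (hg.unbounded k), ?_, Nat.find_spec (hg.unbounded k)⟩
  rcases h : Nat.find (hg.unbounded k) with _ | n
  · simp [waitSum]
  · exact not_lt.1 (Nat.find_min (hg.unbounded k) (m := n) (by lia))

lemma RegularClock.unique_waitSum {g : ℕ → ℝ} (hg : RegularClock g) {t : ℝ} {i j : ℕ}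
    (hi : waitSum i g ≤ t ∧ t < waitSum (i + 1) g)
    (hj : waitSum j g ≤ t ∧ t < waitSum (j + 1) g) : i = j := by
  rcases lt_trichotomy i j with h | h | h
  · exact absurd (hg.monotone (show i + 1 ≤ j from h)) (not_le.2 (hj.1.trans_lt hi.2))
  · exact h
  · exact absurd (hg.monotone (show j + 1 ≤ i from h)) (not_le.2 (hi.1.trans_lt hj.2))

lemma RegularClock.mem_silentSet_iff {g : ℕ → ℝ} (hg : RegularClock g) {k j : ℕ}
    (h1 : waitSum j g ≤ k) (h2 : (k : ℝ) < waitSum (j + 1) g) :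
    g ∈ silentSet k ↔ (k : ℝ) + 1 < waitSum (j + 1) g := by
  refine ⟨fun h => not_le.1 fun h' => h j ⟨h2, h'⟩, fun h n hn => ?_⟩
  rcases lt_or_ge n j with hnj | hnj
  · exact absurd hn.1 (not_lt.2 ((hg.monotone (show n + 1 ≤ j from hnj)).trans h1))
  · exact absurd hn.2 (not_le.2 (h.trans_le (hg.monotone (show j + 1 ≤ n + 1 by lia))))

lemma RegularClock.mem_singleSet_iff {g : ℕ → ℝ} (hg : RegularClock g) {k j : ℕ}
    (h1 : waitSum j g ≤ k) (h2 : (k : ℝ) < waitSum (j + 1) g) :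
    g ∈ singleSet k ↔ waitSum (j + 1) g ≤ k + 1 ∧ (k : ℝ) + 1 < waitSum (j + 2) g := by
  have hle : ∀ n, clockTime g n ∈ Set.Ioc (k : ℝ) (k + 1) → j ≤ n := by
    intro n hn
    by_contra! hnj
    exact absurd hn.1 (not_lt.2 ((hg.monotone (show n + 1 ≤ j from hnj)).trans h1))
  constructor
  · rintro ⟨n, hn, huniq⟩
    have hj : waitSum (j + 1) g ≤ k + 1 :=
      (hg.monotone (show j + 1 ≤ n + 1 by have := hle n hn; lia)).trans hn.2
    refine ⟨hj, not_le.1 fun h => ?_⟩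
    have e1 := huniq j ⟨h2, hj⟩
    have e2 := huniq (j + 1) ⟨h2.trans_le (hg.monotone (show j + 1 ≤ j + 1 + 1 by lia)), h⟩
    lia
  · rintro ⟨h3, h4⟩
    refine ⟨j, ⟨h2, h3⟩, fun n hn => le_antisymm ?_ (hle n hn)⟩
    by_contra! hnj
    exact absurd hn.2 (not_le.2 (h4.trans_le (hg.monotone (show j + 2 ≤ n + 1 by lia))))

/-- The waiting times before the `j`-th. -/
def truncWait (j : ℕ) (g : ℕ → ℝ) : ℕ → ℝ := fun i => if i < j then g i else 0

@[fun_prop]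
lemma measurable_truncWait (j : ℕ) : Measurable (truncWait j) :=
  measurable_pi_lambda _ fun i => by
    unfold truncWait; split_ifs
    exacts [measurable_pi_apply i, measurable_const]

lemma waitSum_truncWait {i j : ℕ} (h : i ≤ j) (g : ℕ → ℝ) :
    waitSum i (truncWait j g) = waitSum i g :=
  Finset.sum_congr rfl fun n hn => if_pos (by rw [Finset.mem_range] at hn; lia)

/-- The past at time `k` when `j` rings have occurred. -/
noncomputable def pastOfCount (k j : ℕ) (w : ℕ → ℝ) : ℕ → ℝ :=
  fun i => if i < j then clockTime w i else k + 1

@[fun_prop]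
lemma measurable_pastOfCount (k j : ℕ) : Measurable (pastOfCount k j) :=
  measurable_pi_lambda _ fun i => by
    unfold pastOfCount; split_ifs
    exacts [measurable_clockTime i, measurable_const]

/-- Once the count `j` is known, the past is a function of the first `j` waiting times, hence
independent of the two that follow. -/
lemma RegularClock.clockPast_eq {g : ℕ → ℝ} (hg : RegularClock g) {k j : ℕ}
    (h1 : waitSum j g ≤ k) (h2 : (k : ℝ) < waitSum (j + 1) g) :
    clockPast k g = pastOfCount k j (truncWait j g) := by
  funext i
  unfold clockPast pastOfCount
  split_ifs with h
  · rw [clockTime_eq_waitSum, clockTime_eq_waitSum, waitSum_truncWait h]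
    exact censor_of_le ((hg.monotone (show i + 1 ≤ j from h)).trans h1)
  · refine if_neg (not_le.2 (h2.trans_le ?_))
    exact hg.monotone (show j + 1 ≤ i + 1 by lia)

lemma indepFun_truncWait (j : ℕ) :
    IndepFun (truncWait j) (fun g => (g j, g (j + 1))) clockLaw := by
  have h := iIndepFun_clockLaw.indepFun_finset (Finset.range j) {j, j + 1}
    (by simp) fun n => measurable_pi_apply n
  have := h.comp (φ := fun y i => if h : i < j then y ⟨i, Finset.mem_range.2 h⟩ else 0)
    (ψ := fun z : ↥({j, j + 1} : Finset ℕ) → ℝ => (z ⟨j, by simp⟩, z ⟨j + 1, by simp⟩))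
    (measurable_pi_lambda _ fun i => by split_ifs <;> fun_prop) (by fun_prop)
  exact this

lemma map_clockLaw_pair (j : ℕ) :
    clockLaw.map (fun g => (g j, g (j + 1))) = (expMeasure 1).prod (expMeasure 1) := by
  have h := iIndepFun_clockLaw.indepFun (show j ≠ j + 1 by lia)
  rw [indepFun_iff_map_prod_eq_prod_map_map (measurable_pi_apply _).aemeasurable
    (measurable_pi_apply _).aemeasurable, map_clockLaw, map_clockLaw] at h
  exact h

/-- Comparison of two events that depend on the waiting times before the `j`-th in the same way. -/
lemma clockLaw_eq_mul_of_section (j : ℕ) {R R' : Set ((ℕ → ℝ) × (ℝ × ℝ))} (hR : MeasurableSet R)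
    (hR' : MeasurableSet R') {c : ENNReal}
    (h : ∀ w, ((expMeasure 1).prod (expMeasure 1)) (Prod.mk w ⁻¹' R) =
      c * ((expMeasure 1).prod (expMeasure 1)) (Prod.mk w ⁻¹' R')) :
    clockLaw ((fun g => (truncWait j g, g j, g (j + 1))) ⁻¹' R) =
      c * clockLaw ((fun g => (truncWait j g, g j, g (j + 1))) ⁻¹' R') := by
  have hm : Measurable fun g : ℕ → ℝ => (truncWait j g, g j, g (j + 1)) := by fun_prop
  have hp : Measurable fun g : ℕ → ℝ => (g j, g (j + 1)) := by fun_prop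
  have hi := indepFun_truncWait j
  rw [indepFun_iff_map_prod_eq_prod_map_map (measurable_truncWait j).aemeasurable
    hp.aemeasurable, map_clockLaw_pair] at hi
  rw [← Measure.map_apply hm hR, ← Measure.map_apply hm hR', hi, Measure.prod_apply hR,
    Measure.prod_apply hR']
  simp_rw [h]
  exact lintegral_const_mul _ (measurable_measure_prodMk_left hR')

/-- If, whatever the number `j` of rings before time `k`, an event about the rings after time `k`
has conditional probability `c`, then it has conditional probability `c` given the past. -/
lemma clockLaw_clockPast_inter (k : ℕ) {C D : Set (ℕ → ℝ)} (hC : MeasurableSet C) {c : ENNReal}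
    (R : ℝ → Set (ℝ × ℝ)) (hR : MeasurableSet {q : ℝ × (ℝ × ℝ) | q.2 ∈ R q.1})
    (hD : ∀ g, RegularClock g → ∀ j, waitSum j g ≤ k → (k : ℝ) < waitSum (j + 1) g →
      (g ∈ D ↔ (g j, g (j + 1)) ∈ R (k - waitSum j g)))
    (hRc : ∀ s, 0 ≤ s → ((expMeasure 1).prod (expMeasure 1)) ({z | s < z.1} ∩ R s) =
      c * ((expMeasure 1).prod (expMeasure 1)) {z | s < z.1}) :
    clockLaw (clockPast k ⁻¹' C ∩ D) = c * clockLaw (clockPast k ⁻¹' C) := by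
  let F : ℕ → (ℕ → ℝ) → (ℕ → ℝ) × (ℝ × ℝ) := fun j g => (truncWait j g, g j, g (j + 1))
  have hF : ∀ j, Measurable (F j) := fun j => by fun_prop
  -- `B j` encodes "the past lies in `C` and exactly `j` rings occurred", in terms of the first `j`
  -- waiting times and the next two; `B' j` adds the event `D`.
  let B : ℕ → Set ((ℕ → ℝ) × (ℝ × ℝ)) := fun j =>
    {q | (pastOfCount k j q.1 ∈ C ∧ waitSum j q.1 ≤ k) ∧ k - waitSum j q.1 < q.2.1}
  let B' : ℕ → Set ((ℕ → ℝ) × (ℝ × ℝ)) := fun j => B j ∩ {q | q.2 ∈ R (k - waitSum j q.1)}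
  have hW : ∀ j, Measurable fun q : (ℕ → ℝ) × (ℝ × ℝ) => waitSum j q.1 := fun j => by fun_prop
  have hB : ∀ j, MeasurableSet (B j) := fun j =>
    ((((measurable_pastOfCount k j).comp measurable_fst) hC).inter
      (measurableSet_le (hW j) measurable_const)).inter
      (measurableSet_lt (measurable_const.sub (hW j)) (measurable_fst.comp measurable_snd))
  have hB' : ∀ j, MeasurableSet (B' j) := fun j => (hB j).inter
    ((show Measurable fun q : (ℕ → ℝ) × (ℝ × ℝ) => ((k : ℝ) - waitSum j q.1, q.2) by fun_prop) hR)
  have hmemB : ∀ g, RegularClock g → ∀ j, F j g ∈ B j ↔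
      clockPast k g ∈ C ∧ waitSum j g ≤ k ∧ (k : ℝ) < waitSum (j + 1) g := by
    intro g hg j
    simp only [B, F, Set.mem_ofPred_eq, waitSum_truncWait le_rfl, waitSum_succ]
    constructor
    · rintro ⟨⟨h1, h2⟩, h3⟩
      have h4 : (k : ℝ) < waitSum (j + 1) g := by rw [waitSum_succ]; linarith
      exact ⟨by rwa [hg.clockPast_eq h2 h4], h2, by linarith⟩
    · rintro ⟨h1, h2, h3⟩
      exact ⟨⟨by rwa [← hg.clockPast_eq h2 (by rwa [waitSum_succ])], h2⟩, by linarith⟩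
  have hmemB' : ∀ g, RegularClock g → ∀ j, F j g ∈ B' j ↔
      (clockPast k g ∈ C ∧ g ∈ D) ∧ waitSum j g ≤ k ∧ (k : ℝ) < waitSum (j + 1) g := by
    intro g hg j
    simp only [B', Set.mem_inter_iff, hmemB g hg]
    constructor
    · rintro ⟨⟨h1, h2, h3⟩, h4⟩
      refine ⟨⟨h1, (hD g hg j h2 h3).2 ?_⟩, h2, h3⟩
      simpa [F, waitSum_truncWait le_rfl] using h4
    · rintro ⟨⟨h1, h4⟩, h2, h3⟩
      refine ⟨⟨h1, h2, h3⟩, ?_⟩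
      simpa [F, waitSum_truncWait le_rfl] using (hD g hg j h2 h3).1 h4
  have e1 : clockLaw (clockPast k ⁻¹' C) = ∑' j, clockLaw (F j ⁻¹' B j) := by
    refine measure_eq_tsum_of_ae (fun j => hF j (hB j)) ?_ ?_
    · filter_upwards [ae_regularClock] with g hg
      simp only [Set.mem_preimage, hmemB g hg]
      obtain ⟨j, hj⟩ := hg.exists_waitSum k
      exact ⟨fun h => ⟨j, h, hj⟩, fun ⟨_, h⟩ => h.1⟩
    · filter_upwards [ae_regularClock] with g hg i j hi hj
      exact hg.unique_waitSum ((hmemB g hg i).1 hi).2 ((hmemB g hg j).1 hj).2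
  have e2 : clockLaw (clockPast k ⁻¹' C ∩ D) = ∑' j, clockLaw (F j ⁻¹' B' j) := by
    refine measure_eq_tsum_of_ae (fun j => hF j (hB' j)) ?_ ?_
    · filter_upwards [ae_regularClock] with g hg
      simp only [Set.mem_preimage, Set.mem_inter_iff, hmemB' g hg]
      obtain ⟨j, hj⟩ := hg.exists_waitSum k
      exact ⟨fun h => ⟨j, h, hj⟩, fun ⟨_, h⟩ => h.1⟩
    · filter_upwards [ae_regularClock] with g hg i j hi hj
      exact hg.unique_waitSum ((hmemB' g hg i).1 hi).2 ((hmemB' g hg j).1 hj).2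
  rw [e1, e2, ← ENNReal.tsum_mul_left]
  -- With the first `j` waiting times frozen at `w`, the elapsed time `s = k - waitSum j w` is fixed
  -- and `hRc` applies; if `w` violates the conditions, both sections are empty.
  refine tsum_congr fun j => clockLaw_eq_mul_of_section j (hB' j) (hB j) fun w => ?_
  by_cases hw : pastOfCount k j w ∈ C ∧ waitSum j w ≤ k
  · have h1 : Prod.mk w ⁻¹' B j = {z | k - waitSum j w < z.1} := by
      ext z; simp [B, hw]
    have h2 : Prod.mk w ⁻¹' B' j = {z | k - waitSum j w < z.1} ∩ R (k - waitSum j w) := by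
      ext z; simp [B', B, hw]
    rw [h1, h2, hRc _ (by linarith [hw.2])]
  · have h1 : Prod.mk w ⁻¹' B j = ∅ := by
      ext z; simp only [B, Set.mem_preimage, Set.mem_ofPred_eq, Set.mem_empty_iff_false]; tauto
    have h2 : Prod.mk w ⁻¹' B' j = ∅ := by
      rw [Set.preimage_inter, h1, Set.empty_inter]
    rw [h1, h2, measure_empty, mul_zero]

/-- Memorylessness: `e^(-(s + 1)) = e⁻¹ e^(-s)`, whatever the elapsed time `s`. -/
lemma clockLaw_clockPast_inter_silentSet (k : ℕ) {C : Set (ℕ → ℝ)} (hC : MeasurableSet C) :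
    clockLaw (clockPast k ⁻¹' C ∩ silentSet k) =
      ENNReal.ofReal (Real.exp (-1)) * clockLaw (clockPast k ⁻¹' C) := by
  refine clockLaw_clockPast_inter k hC (fun s => {z | s + 1 < z.1})
    (measurableSet_lt (f := fun q : ℝ × (ℝ × ℝ) => q.1 + 1) (g := fun q => q.2.1)
      (by fun_prop) (by fun_prop)) (fun g hg j h1 h2 => ?_) fun s hs => ?_
  · rw [hg.mem_silentSet_iff h1 h2, waitSum_succ]
    simp only [Set.mem_ofPred_eq]
    constructor <;> intro h <;> linarith
  · have : {z : ℝ × ℝ | s < z.1} ∩ {z | s + 1 < z.1} = {z | s + 1 < z.1} := by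
      ext z
      exact ⟨fun h => h.2, fun h => ⟨show s < z.1 from (lt_add_one s).trans h, h⟩⟩
    rw [this, expMeasure_prod_Ioi (by linarith), expMeasure_prod_Ioi hs,
      ← ENNReal.ofReal_mul (Real.exp_pos _).le, ← Real.exp_add]
    ring_nf

/-- A rate `1` Poisson clock has exactly one ring in a unit interval with probability `1 · e⁻¹`, the
same value as for silence. -/
lemma clockLaw_clockPast_inter_singleSet (k : ℕ) {C : Set (ℕ → ℝ)} (hC : MeasurableSet C) :
    clockLaw (clockPast k ⁻¹' C ∩ singleSet k) =
      ENNReal.ofReal (Real.exp (-1)) * clockLaw (clockPast k ⁻¹' C) := by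
  refine clockLaw_clockPast_inter k hC (fun s => {z | z.1 ≤ s + 1 ∧ s + 1 < z.1 + z.2})
    ((measurableSet_le (f := fun q : ℝ × (ℝ × ℝ) => q.2.1) (g := fun q => q.1 + 1)
      (by fun_prop) (by fun_prop)).inter (measurableSet_lt (f := fun q : ℝ × (ℝ × ℝ) => q.1 + 1)
      (g := fun q => q.2.1 + q.2.2) (by fun_prop) (by fun_prop))) (fun g hg j h1 h2 => ?_)
    fun s hs => ?_
  · rw [hg.mem_singleSet_iff h1 h2, waitSum_succ (j + 1), waitSum_succ j]
    simp only [Set.mem_ofPred_eq]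
    constructor <;> rintro ⟨h3, h4⟩ <;> constructor <;> linarith
  · have : {z : ℝ × ℝ | s < z.1} ∩ {z | z.1 ≤ s + 1 ∧ s + 1 < z.1 + z.2} =
        {z : ℝ × ℝ | s < z.1 ∧ z.1 ≤ s + 1 ∧ s + 1 < z.1 + z.2} := rfl
    rw [this, expMeasure_prod_single hs, expMeasure_prod_Ioi hs,
      ← ENNReal.ofReal_mul (Real.exp_pos _).le, ← Real.exp_add]
    ring_nf

/-! ### Isolated rings are independent of the past -/

lemma siteLaw_apply {S : Set Site} (hS : MeasurableSet S) :
    siteLaw S = ∫⁻ a, ∫⁻ c, clockLaw {g | (a, g, c) ∈ S} ∂coinLaw ∂AddCircle.haarAddCircle := by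
  rw [siteLaw, Measure.prod_apply hS]
  refine lintegral_congr fun a => ?_
  rw [Measure.prod_apply_symm (measurable_prodMk_left hS)]
  rfl

/-- For a frozen initial opinion and frozen coins, this is the hypothesis on the single clock. -/
lemma siteLaw_sitePast_inter (k : ℕ) {D : Set (ℕ → ℝ)} (hD : MeasurableSet D)
    {c : ENNReal} (h : ∀ C, MeasurableSet C →
      clockLaw (clockPast k ⁻¹' C ∩ D) = c * clockLaw (clockPast k ⁻¹' C))
    {C : Set Site} (hC : MeasurableSet C) :
    siteLaw (sitePast k ⁻¹' C ∩ {s | s.2.1 ∈ D}) = c * siteLaw (sitePast k ⁻¹' C) := by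
  have hm : MeasurableSet (sitePast k ⁻¹' C) := measurable_sitePast k hC
  have hD' : MeasurableSet {s : Site | s.2.1 ∈ D} :=
    (show Measurable fun s : Site => s.2.1 by fun_prop) hD
  have hsec : Measurable fun p : Opinion × (ℕ → Bool) =>
      clockLaw {g | (p.1, g, p.2) ∈ sitePast k ⁻¹' C} :=
    measurable_measure_prodMk_left (ν := clockLaw)
      (s := (fun q : (Opinion × (ℕ → Bool)) × (ℕ → ℝ) => ((q.1.1, q.2, q.1.2) : Site)) ⁻¹'
        (sitePast k ⁻¹' C)) ((by fun_prop : Measurable _) hm)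
  rw [siteLaw_apply (hm.inter hD'), siteLaw_apply hm,
    ← lintegral_const_mul _ (hsec.lintegral_prod_right' (ν := coinLaw))]
  refine lintegral_congr fun a => ?_
  refine Eq.trans ?_ (lintegral_const_mul c (hsec.comp (measurable_prodMk_left (x := a))))
  refine lintegral_congr fun b => ?_
  exact h {t | (a, t, b) ∈ C} ((by fun_prop : Measurable fun t => ((a, t, b) : Site)) hC)

/-- Taking the whole space for `C` shows that `c` is the probability of `D`. The event is phrased as
a `Prop`-valued map so that `indepFun_infinitePi_map` applies. -/
lemma indepFun_sitePast (k : ℕ) {D : Set (ℕ → ℝ)} (hD : MeasurableSet D)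
    {c : ENNReal} (h : ∀ C, MeasurableSet C →
      clockLaw (clockPast k ⁻¹' C ∩ D) = c * clockLaw (clockPast k ⁻¹' C)) :
    IndepFun (sitePast k) (fun s : Site => s.2.1 ∈ D) siteLaw := by
  have hD' : MeasurableSet {s : Site | s.2.1 ∈ D} :=
    (show Measurable fun s : Site => s.2.1 by fun_prop) hD
  have hc : siteLaw {s : Site | s.2.1 ∈ D} = c := by
    have := siteLaw_sitePast_inter k hD h MeasurableSet.univ
    simpa using this
  refine IndepSets.indep (measurable_sitePast k).comap_le (measurableSet_setOfPred.1 hD').comap_le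
    (@MeasurableSpace.isPiSystem_measurableSet Site (.comap (sitePast k) inferInstance))
    (IsPiSystem.singleton {s : Site | s.2.1 ∈ D})
    (@MeasurableSpace.generateFrom_measurableSet Site (.comap (sitePast k) inferInstance)).symm
    (MeasurableSpace.generateFrom_singleton _).symm ?_
  rw [IndepSets_iff]
  rintro - - ⟨C, hC, rfl⟩ rfl
  rw [siteLaw_sitePast_inter k hD h hC, hc, mul_comm]

/-- The requirements on the clocks around `v` for an isolated ring. -/
def ringPattern (k : ℕ) (v i : ℤ) : Set (ℕ → ℝ) := if i = v then singleSet k else silentSet k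

lemma measurableSet_ringPattern (k : ℕ) (v i : ℤ) : MeasurableSet (ringPattern k v i) := by
  unfold ringPattern; split_ifs
  exacts [measurableSet_singleSet k, measurableSet_silentSet k]

lemma clockLaw_clockPast_inter_ringPattern (k : ℕ) (v i : ℤ) (C : Set (ℕ → ℝ))
    (hC : MeasurableSet C) : clockLaw (clockPast k ⁻¹' C ∩ ringPattern k v i) =
      ENNReal.ofReal (Real.exp (-1)) * clockLaw (clockPast k ⁻¹' C) := by
  unfold ringPattern; split_ifs
  exacts [clockLaw_clockPast_inter_singleSet k hC, clockLaw_clockPast_inter_silentSet k hC]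

lemma isolatedRing_eq (k : ℕ) (v : ℤ) :
    isolatedRing k v = {x | (x (v - 1)).2.1 ∈ ringPattern k v (v - 1) ∧
      (x v).2.1 ∈ ringPattern k v v ∧ (x (v + 1)).2.1 ∈ ringPattern k v (v + 1)} := by
  simp [isolatedRing, ringPattern]

lemma measurableSet_isolatedRing (k : ℕ) (v : ℤ) : MeasurableSet (isolatedRing k v) :=
  past.le _ _ (measurableSet_past_isolatedRing k v)

lemma measureReal_isolatedRing (k : ℕ) (v : ℤ) :
    noiseLaw.real (isolatedRing k v) = Real.exp (-1) ^ 3 := by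
  have hm : ∀ i, MeasurableSet {s : Site | s.2.1 ∈ ringPattern k v i} := fun i =>
    (show Measurable fun s : Site => s.2.1 by fun_prop) (measurableSet_ringPattern k v i)
  have h1 : isolatedRing k v = (({v - 1, v, v + 1} : Finset ℤ) : Set ℤ).pi
      fun i => {s : Site | s.2.1 ∈ ringPattern k v i} := by
    rw [isolatedRing_eq]
    ext x
    simp
  have h2 : ∀ i, siteLaw {s : Site | s.2.1 ∈ ringPattern k v i} =
      ENNReal.ofReal (Real.exp (-1)) := fun i => by
    have := siteLaw_sitePast_inter k (measurableSet_ringPattern k v i)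
      (clockLaw_clockPast_inter_ringPattern k v i) MeasurableSet.univ
    simpa using this
  have h3 : ({v - 1, v, v + 1} : Finset ℤ).card = 3 := by
    rw [Finset.card_eq_three]
    exact ⟨v - 1, v, v + 1, by lia, by lia, by lia, rfl⟩
  rw [measureReal_def, h1, noiseLaw, Measure.infinitePi_pi _ fun i _ => hm i]
  simp_rw [h2]
  rw [Finset.prod_const, h3, ENNReal.toReal_pow, ENNReal.toReal_ofReal (Real.exp_pos _).le]

lemma condExp_isolatedRing (k : ℕ) (v : ℤ) :
    noiseLaw[(isolatedRing k v).indicator (1 : (ℤ → Site) → ℝ) | past k] =ᵐ[noiseLaw]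
      fun _ => Real.exp (-1) ^ 3 := by
  -- The pattern is prescribed at every site to match the product lemma; the isolated ring reads
  -- only three of them.
  have hind : IndepFun (fun (x : ℤ → Site) i => sitePast k (x i))
      (fun x i => (x i).2.1 ∈ ringPattern k v i) noiseLaw :=
    indepFun_infinitePi_map (measurable_sitePast k)
      (fun i => measurableSet_setOfPred.1 ((show Measurable fun s : Site => s.2.1 by fun_prop)
        (measurableSet_ringPattern k v i)))
      fun i => indepFun_sitePast k (measurableSet_ringPattern k v i)
        (clockLaw_clockPast_inter_ringPattern k v i)
  have hG : Measurable fun (x : ℤ → Site) i => (x i).2.1 ∈ ringPattern k v i :=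
    measurable_pi_lambda _ fun i => measurableSet_setOfPred.1
      ((show Measurable fun x : ℤ → Site => (x i).2.1 by fun_prop)
        (measurableSet_ringPattern k v i))
  have hI : MeasurableSet[MeasurableSpace.comap
      (fun (x : ℤ → Site) i => (x i).2.1 ∈ ringPattern k v i) inferInstance]
      (isolatedRing k v) := by
    refine ⟨{y | y (v - 1) ∧ y v ∧ y (v + 1)}, ?_, by rw [isolatedRing_eq]; rfl⟩
    have hc : ∀ i, MeasurableSet {y : ℤ → Prop | y i} := fun i =>
      measurableSet_setOfPred.2 (measurable_pi_apply i)
    exact (hc _).inter ((hc _).inter (hc _))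
  have h1 := condExp_indep_eq (μ := noiseLaw) (m₂ := past k)
    (f := (isolatedRing k v).indicator (1 : (ℤ → Site) → ℝ)) hG.comap_le (past.le k)
    ((stronglyMeasurable_one (α := ℤ → Site)).indicator hI) hind.symm
  refine h1.trans (ae_of_all _ fun x => ?_)
  dsimp only
  rw [integral_indicator_one (measurableSet_isolatedRing k v), measureReal_isolatedRing]

/-- Lévy's Borel-Cantelli lemma: events that are determined by the past and occur infinitely often
are infinitely often followed by an isolated ring. -/
lemma ae_frequently_inter_isolatedRing (v : ℤ) {B : ℕ → Set (ℤ → Site)}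
    (hB : ∀ k, MeasurableSet[past k] (B k)) :
    ∀ᵐ x ∂noiseLaw, (∃ᶠ k in atTop, x ∈ B k) → ∃ᶠ k in atTop, x ∈ B k ∩ isolatedRing k v := by
  -- The index moves by one because the ring after time `k` is known only at time `k + 1`; the empty
  -- set at `0` is a filler.
  let s : ℕ → Set (ℤ → Site) := fun n => n.casesOn ∅ fun k => B k ∩ isolatedRing k v
  have hs : ∀ n, MeasurableSet[past n] (s n) := by
    rintro (_ | k)
    · exact @MeasurableSet.empty _ (past 0)
    · exact @MeasurableSet.inter _ (past (k + 1)) _ _ (past.mono (Nat.le_succ k) _ (hB k))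
        (measurableSet_past_isolatedRing k v)
  have hcond : ∀ᵐ x ∂noiseLaw, ∀ k,
      (noiseLaw[(s (k + 1)).indicator (1 : (ℤ → Site) → ℝ) | past k]) x =
        (B k).indicator (fun _ => Real.exp (-1) ^ 3) x := by
    refine ae_all_iff.2 fun k => ?_
    have h1 := condExp_indicator (μ := noiseLaw) (m := past k)
      (f := (isolatedRing k v).indicator (1 : (ℤ → Site) → ℝ))
      ((integrable_const 1).indicator (measurableSet_isolatedRing k v)) (hB k)
    rw [Set.indicator_indicator] at h1
    filter_upwards [h1, condExp_isolatedRing k v] with x hx hx'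
    change (noiseLaw[(B k ∩ isolatedRing k v).indicator (1 : (ℤ → Site) → ℝ) | past k]) x = _
    rw [hx]
    simp only [Set.indicator, hx']
  filter_upwards [ae_mem_limsup_atTop_iff noiseLaw hs, hcond] with x hx hc hfreq
  have h1 : x ∈ limsup B atTop := by rwa [mem_limsup_iff_frequently_mem]
  -- Infinitely many `B k`, each contributing `e⁻³`, make the sum of conditional probabilities
  -- diverge.
  rw [Set.limsup_eq_tendsto_sum_indicator_atTop (show 0 < Real.exp (-1) ^ 3 by positivity)] at h1
  simp_rw [hc] at hx
  have h2 := hx.2 h1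
  rw [← limsup_nat_add s 1, mem_limsup_iff_frequently_mem] at h2
  exact h2

/-! ### Convergence at one vertex spreads to the neighbour -/

lemma measurableSet_lt_dist {α : Type*} {m : MeasurableSpace α} {f g : α → Opinion}
    (hf : Measurable f) (hg : Measurable g) (ε : ℝ) : MeasurableSet {a | ε < dist (f a) (g a)} :=
  measurableSet_lt measurable_const (hf.dist hg)

lemma ae_tendsto_succ {μ : ℝ} (hμ : 0 < μ) (hμ' : μ ≤ 1 / 2) (v : ℤ) :
    ∀ᵐ x ∂noiseLaw, ∀ L, Tendsto (fun k => eta μ x k v) atTop (𝓝 L) →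
      Tendsto (fun k => eta μ x k (v + 1)) atTop (𝓝 L) := by
  -- Thresholds `1 / (m + 1)` keep the exceptional null sets countable in number.
  have h : ∀ᵐ x ∂noiseLaw, ∀ m : ℕ,
      (∃ᶠ k in atTop, x ∈ {x | 1 / ((m : ℝ) + 1) < dist (eta μ x k v) (eta μ x k (v + 1))}) →
      ∃ᶠ k in atTop, x ∈ {x | 1 / ((m : ℝ) + 1) < dist (eta μ x k v) (eta μ x k (v + 1))} ∩
        isolatedRing k v :=
    ae_all_iff.2 fun m => ae_frequently_inter_isolatedRing v fun k =>
      measurableSet_lt_dist (measurable_past_eta μ k v) (measurable_past_eta μ k (v + 1)) _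
  filter_upwards [h, ae_regular] with x hx hreg L hL
  have hstep : Tendsto (fun k => dist (eta μ x (k + 1) v) (eta μ x k v)) atTop (𝓝 0) := by
    have := ((tendsto_add_atTop_iff_nat 1).2 hL).dist hL
    rwa [dist_self] at this
  have hdist : Tendsto (fun k => dist (eta μ x k v) (eta μ x k (v + 1))) atTop (𝓝 0) := by
    rw [Metric.tendsto_atTop']
    by_contra! hcon
    obtain ⟨ε, hε, hcon⟩ := hcon
    obtain ⟨m, hm⟩ := exists_nat_one_div_lt hε
    have hfreq : ∃ᶠ k in atTop,
        x ∈ {x | 1 / ((m : ℝ) + 1) < dist (eta μ x k v) (eta μ x k (v + 1))} := by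
      rw [frequently_atTop]
      intro N
      obtain ⟨k, hk, hk'⟩ := hcon N
      rw [Real.dist_0_eq_abs, abs_of_nonneg dist_nonneg] at hk'
      exact ⟨k, hk.le, hm.trans_le hk'⟩
    refine hx m hfreq ?_
    have hpos : 0 < μ * (1 / ((m : ℝ) + 1)) := by positivity
    -- Eventually every step is below `μ / (m + 1)`, whereas an isolated ring at a large distance
    -- makes a longer one.
    filter_upwards [hstep.eventually_lt_const hpos] with k hk ⟨h1, h2⟩
    have h3 : dist (eta μ x (k + 1) v) (eta μ x k v) =
        μ * dist (eta μ x k v) (eta μ x k (v + 1)) :=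
      hreg.dist_opinion_succ hμ hμ' _ _ h2.1 h2.2.2 h2.2.1
    rw [h3] at hk
    exact absurd (lt_of_mul_lt_mul_left hk hμ.le) (not_lt.2 (le_of_lt h1))
  exact (tendsto_iff_of_dist hdist).1 hL

/-- The event that the opinion at `v` converges, along integer times, to a limit in `S`. -/
def convergesIn (μ : ℝ) (v : ℤ) (S : Set Opinion) : Set (ℤ → Site) :=
  {x | ∃ L ∈ S, Tendsto (fun k => eta μ x k v) atTop (𝓝 L)}

lemma convergesIn_eq (μ : ℝ) (v : ℤ) (S : Set Opinion) :
    convergesIn μ v S = {x | ∃ L, Tendsto (fun k => eta μ x k v) atTop (𝓝 L)} ∩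
      (fun x => limUnder atTop fun k => eta μ x k v) ⁻¹' S := by
  ext x
  constructor
  · rintro ⟨L, hLS, hL⟩
    exact ⟨⟨L, hL⟩, by rw [Set.mem_preimage, hL.limUnder_eq]; exact hLS⟩
  · rintro ⟨⟨L, hL⟩, hS⟩
    rw [Set.mem_preimage, hL.limUnder_eq] at hS
    exact ⟨L, hS, hL⟩

lemma measurableSet_convergesIn (μ : ℝ) (v : ℤ) {S : Set Opinion} (hS : MeasurableSet S) :
    MeasurableSet (convergesIn μ v S) := by
  have h : ∀ k, StronglyMeasurable fun x => eta μ x k v := fun k =>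
    (measurable_eta μ k v).stronglyMeasurable
  rw [convergesIn_eq]
  exact (StronglyMeasurable.measurableSet_exists_tendsto h).inter
    ((StronglyMeasurable.limUnder h).measurable hS)

/-- Convergence spreads to the right with an unchanged limit, so membership of the limit in `S` is
kept; translation equivariance turns `v + n` into a shift of the noise. -/
lemma ae_convergesIn_shift {μ : ℝ} (hμ : 0 < μ) (hμ' : μ ≤ 1 / 2) (v : ℤ) (S : Set Opinion)
    (n : ℕ) : ∀ᵐ x ∂noiseLaw, x ∈ convergesIn μ v S → shift n x ∈ convergesIn μ v S := by
  have h : ∀ᵐ x ∂noiseLaw, ∀ m : ℕ, ∀ L, Tendsto (fun k => eta μ x k (v + m)) atTop (𝓝 L) →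
      Tendsto (fun k => eta μ x k (v + m + 1)) atTop (𝓝 L) :=
    ae_all_iff.2 fun m => ae_tendsto_succ hμ hμ' (v + m)
  have hreg' : ∀ᵐ x ∂noiseLaw, Regular fun e => (shift (n : ℤ) x e).2.1 :=
    (measurePreserving_shift siteLaw (n : ℤ)).quasiMeasurePreserving.ae ae_regular
  filter_upwards [h, ae_regular, hreg'] with x hx hreg hreg' ⟨L, hLS, hL⟩
  refine ⟨L, hLS, ?_⟩
  have hn : ∀ m : ℕ, Tendsto (fun k => eta μ x k (v + m)) atTop (𝓝 L) := by
    intro m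
    induction m with
    | zero => simpa using hL
    | succ m ih => have := hx m L ih; push_cast; rwa [← add_assoc]
  refine (hn n).congr fun k => ?_
  exact (hreg.opinion_shift (n : ℤ) hreg' μ (fun u => (x u).1) (fun e => (x e).2.2) k v).symm

lemma measureReal_convergesIn_rotate {μ : ℝ} (v : ℤ) {S : Set Opinion} (hS : MeasurableSet S)
    (r : Opinion) : noiseLaw.real (convergesIn μ v ((· + r) ⁻¹' S)) =
      noiseLaw.real (convergesIn μ v S) := by
  rw [← (measurePreserving_rotate r).measureReal_preimage
    (measurableSet_convergesIn μ v hS).nullMeasurableSet]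
  refine measureReal_congr ?_
  filter_upwards [ae_regular] with x hreg
  have he : ∀ k, eta μ (rotate r x) k v = eta μ x k v + r := fun k =>
    hreg.opinion_add μ (fun u => (x u).1) (fun e => (x e).2.2) k v r
  refine propext ⟨?_, ?_⟩
  · rintro ⟨L, hLS, hL⟩
    refine ⟨L + r, hLS, ?_⟩
    simp_rw [he]
    exact hL.add_const r
  · rintro ⟨L, hLS, hL⟩
    refine ⟨L - r, by simpa using hLS, ?_⟩
    simp_rw [he] at hL
    simpa using hL.sub_const r

/-- Along integer times, the opinion at `v` almost surely does not converge. -/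
lemma noiseLaw_convergesIn_univ {μ : ℝ} (hμ : 0 < μ) (hμ' : μ ≤ 1 / 2) (v : ℤ) :
    noiseLaw (convergesIn μ v Set.univ) = 0 := by
  -- The half circle `(-1, 0]`; adding `1` exchanges it with `(0, 1]`.
  let S : Set Opinion := {y | (AddCircle.measurableEquivIoc (2 : ℝ) (-1) y : ℝ) ≤ 0}
  have hS : MeasurableSet S :=
    (measurable_subtype_coe.comp (AddCircle.measurableEquivIoc (2 : ℝ) (-1)).measurable)
      measurableSet_Iic
  have hrot : ((· + ((1 : ℝ) : Opinion)) ⁻¹' S) = Sᶜ := by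
    ext y
    have hy := (AddCircle.equivIoc (2 : ℝ) (-1) y).2
    have hcoe : ((AddCircle.equivIoc (2 : ℝ) (-1) y : ℝ) : Opinion) = y :=
      AddCircle.coe_equivIoc
    set a : ℝ := (AddCircle.equivIoc (2 : ℝ) (-1) y : ℝ) with ha
    have hyS : y ∈ S ↔ a ≤ 0 := Iff.rfl
    rw [Set.mem_preimage, Set.mem_compl_iff, hyS]
    rcases le_or_gt a 0 with h | h
    · have h1 : y + ((1 : ℝ) : Opinion) = ((a + 1 : ℝ) : Opinion) := by
        rw [AddCircle.coe_add, hcoe]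
      have h2 : (AddCircle.equivIoc (2 : ℝ) (-1) (y + ((1 : ℝ) : Opinion)) : ℝ) = a + 1 := by
        rw [h1, AddCircle.equivIoc_coe_eq ⟨by linarith [hy.1], by linarith⟩]
      have h3 : y + ((1 : ℝ) : Opinion) ∈ S ↔ a + 1 ≤ 0 := by rw [← h2]; exact Iff.rfl
      rw [h3]
      constructor
      · intro h4; exact absurd h4 (by linarith [hy.1])
      · intro h4; exact absurd h h4
    · have h1 : y + ((1 : ℝ) : Opinion) = ((a - 1 : ℝ) : Opinion) := by
        have : ((2 : ℝ) : Opinion) = 0 := AddCircle.coe_period 2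
        rw [show a - 1 = a + 1 - 2 by ring, AddCircle.coe_sub, this, sub_zero, AddCircle.coe_add,
          hcoe]
      have h2 : (AddCircle.equivIoc (2 : ℝ) (-1) (y + ((1 : ℝ) : Opinion)) : ℝ) = a - 1 := by
        rw [h1, AddCircle.equivIoc_coe_eq ⟨by linarith, by linarith [hy.2]⟩]
      have h3 : y + ((1 : ℝ) : Opinion) ∈ S ↔ a - 1 ≤ 0 := by rw [← h2]; exact Iff.rfl
      rw [h3]
      exact ⟨fun _ => not_le.2 h, fun _ => by linarith [hy.2]⟩
  set q := noiseLaw.real (convergesIn μ v S) with hq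
  have hq2 : q = q ^ 2 := measureReal_eq_sq_of_shift siteLaw (measurableSet_convergesIn μ v hS)
    (ae_convergesIn_shift hμ hμ' v S)
  have hqc : noiseLaw.real (convergesIn μ v Sᶜ) = q := by
    rw [← hrot, measureReal_convergesIn_rotate v hS]
  have hunion : convergesIn μ v Set.univ = convergesIn μ v S ∪ convergesIn μ v Sᶜ := by
    ext x
    simp only [convergesIn, Set.mem_union, Set.mem_ofPred_eq, Set.mem_compl_iff, Set.mem_univ,
      true_and, ← exists_or, ← or_and_right, em]
  have hdisj : Disjoint (convergesIn μ v S) (convergesIn μ v Sᶜ) := by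
    rw [Set.disjoint_left]
    rintro x ⟨L, hLS, hL⟩ ⟨L', hLS', hL'⟩
    exact hLS' (tendsto_nhds_unique hL hL' ▸ hLS)
  have hsum : noiseLaw.real (convergesIn μ v Set.univ) = q + q := by
    rw [hunion, measureReal_union hdisj (measurableSet_convergesIn μ v hS.compl), hqc]
  have hle : q + q ≤ 1 := hsum ▸ measureReal_le_one
  have h0 : q = 0 := by nlinarith [measureReal_nonneg (μ := noiseLaw) (s := convergesIn μ v S)]
  rw [h0, add_zero] at hsum
  exact (measureReal_eq_zero_iff).1 hsum

end Compass

theorem corollary5p3 {Ω : Type*} [MeasurableSpace Ω] (P : Measure Ω) [IsProbabilityMeasure P]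
    (μ : ℝ) (hμ_pos : 0 < μ) (hμ_le : μ ≤ 1 / 2)
    (init : ℤ → Ω → Compass.Opinion) (gap : ℤ → ℕ → Ω → ℝ) (coin : ℤ → ℕ → Ω → Bool)
    (hnoise : Compass.IsUniformCompassNoise P init gap coin) (v : ℤ) :
    P {ω | ∃ L : Compass.Opinion, Tendsto
      (fun t : ℝ => Compass.opinion μ (fun u => init u ω) (fun e k => gap e k ω)
        (fun e n => coin e n ω) t v) atTop (𝓝 L)} = 0 := by
  have h := Compass.noiseLaw_convergesIn_univ hμ_pos hμ_le v
  rw [← hnoise.hasLaw.map_eq, Measure.map_apply_of_aemeasurable hnoise.hasLaw.aemeasurable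
    (Compass.measurableSet_convergesIn μ v MeasurableSet.univ)] at h
  -- Inclusion in a null set suffices, so the real-time event need not be shown measurable.
  refine measure_mono_null ?_ h
  rintro ω ⟨L, hL⟩
  exact ⟨L, Set.mem_univ L, hL.comp tendsto_natCast_atTop_atTop⟩
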